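/- Let $G$ be a Hausdorff topological group and let $X$ be a $G$-Banach space, i.e. a real Banach space with an action of $G$ by linear isometries such that $G\times X\to X$ is continuous. **Definitions.** Let $(\Omega,\Sigma,\mu)$ be a finite measure space. An action of $G$ on it by regular set isomorphisms is a homomorphism from $G$ to the group of maps $T:\Sigma\to\Sigma$, defined modulo null sets, which respect complements and countable disjoint unions modulo null sets and satisfy $\mu(TA)=0\iff\mu(A)=0$. Put $g_*\mu(A)=\mu(g^{-1}A)$ and $h_g=\frac{dg_*\mu}{d\mu}$. The action is continuous if $g\mapsto U_gf$ is continuous for every $f\in L_1(\mu)$, where $U_g$ is the bounded linear operator on $L_1(\mu)$ with $U_g\chi_A=h_g\chi_{gA}$. * $X$ has the *$G$-RNP* if for every finite measure space $(\Omega,\Sigma,\mu)$ with a continuous action of $G$ by regular set isomorphisms, and every countably additive $m:\Sigma\to X$ with $|m|\ll\mu$ that is $G$-quasi-invariant, there is $f\in L_1(\mu;X)$ with $m(A)=\int_Af\,d\mu$ for all $A\in\Sigma$. Here $m$ is $G$-quasi-invariant if $T_m(\chi_A)=m(A)$ $(A\in\Sigma)$ defines a bounded linear operator $T_m:L_1(\mu)\to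 X$ and $g\cdot m(A)=T_m(h_g\chi_{gA})$ for all $g\in G$, $A\in\Sigma$. * $f\in L_1(\mu;X)$ is *$G$-equivariant-on-sets* if, for all $g\in G$ and $A\in\Sigma$, $h_gf$ is integrable and $\int_A g\cdot f\,d\mu=\int_{gA}f\,h_g\,d\mu$. A *$G$-equivariant-on-sets martingale* is a martingale $(M_n)_{n\ge0}$ of such functions with respect to a filtration of $G$-invariant (modulo null sets) sub-$\sigma$-algebras of $\Sigma$. * $X$ is *weakly $G$-dentable* if every nonempty bounded $C\subseteq X$ with $g\cdot C\subseteq C$ for all $g\in G$ is dentable: for every $\varepsilon>0$ there is $x\in C$ with $x\notin\overline{\mathrm{co}}\,(C\setminus B_\varepsilon(x))$. * $G$ has *property $\mathcal F$* if there are a finite measure space $(\Omega,\Sigma,\mu)$ and an action of $G$ on the set $\Omega$ by measurable bijections preserving the measure class of $\mu$, such that the induced action by regular set isomorphisms is continuous; $\mu(\{\omega: g\omega=\omega\})=0$ for every $g\ne1_G$; and there is a measurable fundamental domain, i.e. a set $F\in\Sigma$ such that the sets $gF$ $(g\in G)$ are pairwise disjoint, $\mu(\Omega\setminus\bigcup_{g\in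 G}gF)=0$, and for every nonempty open $V\subseteq G$ the set $\bigcup_{g\in V}gF$ is $\mu$-measurable (i.e. belongs to the $\mu$-completion of $\Sigma$) and has positive measure. **Theorem.** Consider the following conditions. 1. $X$ has the $G$-RNP. 2. For every finite measure space $(\Omega,\Sigma,\mu)$ with a continuous action of $G$ by regular set isomorphisms, every $X$-valued $G$-equivariant-on-sets martingale $(M_n)$ with $\sup_n\|M_n\|_{L_\infty}<\infty$ converges a.e. and in $L_1(\mu;X)$. 3. $X$ is weakly $G$-dentable. Then $(1)\Rightarrow(2)$ for every $G$; $(2)\Rightarrow(3)$ if $G$ has property $\mathcal F$; and $(3)\Rightarrow(1)$ if $G$ is separable. In particular, if $G$ is locally compact, $\sigma$-compact and separable, then all three conditions are equivalent. -/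

import Mathlib

open MeasureTheory Filter Topology
open scoped ENNReal Pointwise

universe u v w

noncomputable section

namespace EquivRNP

/-! ### Actions on measure spaces by regular set isomorphisms -/

/-- A regular set isomorphism of `(Ω, Σ, μ)`: a map `T : Σ → Σ`, defined modulo null sets, which
modulo null sets commutes with relative complements in `T Ω` and with countable disjoint unions,
and which preserves and reflects null sets. (The values of `T` on non-measurable sets are
irrelevant.) -/
structure IsRegularSetIso {Ω : Type*} [MeasurableSpace Ω] (μ : Measure Ω)
    (T : Set Ω → Set Ω) : Prop where
  measurableSet : ∀ A, MeasurableSet A → MeasurableSet (T A)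
  congr : ∀ A B, MeasurableSet A → MeasurableSet B → A =ᵐ[μ] B → T A =ᵐ[μ] T B
  compl : ∀ A, MeasurableSet A → T Aᶜ =ᵐ[μ] (T Set.univ \ T A : Set Ω)
  iUnion : ∀ A : ℕ → Set Ω, (∀ n, MeasurableSet (A n)) → Pairwise (Function.onFun Disjoint A) →
    T (⋃ n, A n) =ᵐ[μ] (⋃ n, T (A n) : Set Ω)
  null_iff : ∀ A, MeasurableSet A → (μ (T A) = 0 ↔ μ A = 0)

/-- An action of `G` on `(Ω, Σ, μ)` by regular set isomorphisms, that is, a homomorphism from `G`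
to the group of regular set isomorphisms (identified when they agree modulo null sets).
`α.act g A` is the set `g A`, which is determined modulo null sets. -/
structure SetAction (G : Type*) [Group G] {Ω : Type*} [MeasurableSpace Ω] (μ : Measure Ω) where
  act : G → Set Ω → Set Ω
  regular : ∀ g, IsRegularSetIso μ (act g)
  act_one : ∀ A, MeasurableSet A → act 1 A =ᵐ[μ] A
  act_mul : ∀ g h A, MeasurableSet A → act (g * h) A =ᵐ[μ] act g (act h A)

namespace IsRegularSetIso

variable {Ω : Type*} [MeasurableSpace Ω] {μ : Measure Ω} {T : Set Ω → Set Ω}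

theorem measure_empty (hT : IsRegularSetIso μ T) : μ (T ∅) = 0 :=
  (hT.null_iff ∅ MeasurableSet.empty).2 (by simp)

theorem union (hT : IsRegularSetIso μ T) {A B : Set Ω} (hA : MeasurableSet A)
    (hB : MeasurableSet B) (hAB : Disjoint A B) : T (A ∪ B) =ᵐ[μ] (T A ∪ T B : Set Ω) := by
  classical
  let S : ℕ → Set Ω := fun n => if n = 0 then A else if n = 1 then B else ∅
  have hS : ∀ n, MeasurableSet (S n) := by
    intro n
    simp only [S]
    split_ifs
    · exact hA
    · exact hB
    · exact MeasurableSet.empty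
  have hd : Pairwise (Function.onFun Disjoint S) := by
    intro i j hij
    simp only [Function.onFun, S]
    split_ifs with h1 h2 h3 h4 h5 h6 <;> first | omega | simp_all [disjoint_comm]
  have hU : (⋃ n, S n) = A ∪ B := by
    ext x
    simp only [Set.mem_iUnion, Set.mem_union]
    constructor
    · rintro ⟨n, hn⟩
      simp only [S] at hn
      split_ifs at hn
      · exact Or.inl hn
      · exact Or.inr hn
      · exact hn.elim
    · rintro (h | h)
      · exact ⟨0, by simpa [S] using h⟩
      · exact ⟨1, by simpa [S] using h⟩
  have h := hT.iUnion S hS hd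
  rw [hU] at h
  refine h.trans ?_
  have h0 : ∀ᵐ x ∂μ, x ∉ T ∅ := measure_eq_zero_iff_ae_notMem.1 hT.measure_empty
  filter_upwards [h0] with x hx
  apply propext
  change x ∈ (⋃ n, T (S n)) ↔ x ∈ T A ∪ T B
  simp only [Set.mem_iUnion, Set.mem_union]
  constructor
  · rintro ⟨n, hn⟩
    simp only [S] at hn
    split_ifs at hn
    · exact Or.inl hn
    · exact Or.inr hn
    · exact (hx hn).elim
  · rintro (h | h)
    · exact ⟨0, by simpa [S] using h⟩
    · exact ⟨1, by simpa [S] using h⟩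

theorem aedisjoint (hT : IsRegularSetIso μ T) {A B : Set Ω} (hA : MeasurableSet A)
    (hB : MeasurableSet B) (hAB : Disjoint A B) : AEDisjoint μ (T A) (T B) := by
  have hB' : MeasurableSet (Aᶜ \ B) := hA.compl.diff hB
  have hsub : B ∪ (Aᶜ \ B) = Aᶜ :=
    Set.union_sdiff_cancel (Set.subset_compl_iff_disjoint_left.2 hAB)
  have h1 := hT.union hB hB' Set.disjoint_sdiff_right
  rw [hsub] at h1
  have h2 := (hT.compl A hA).symm.trans h1
  rw [AEDisjoint, measure_eq_zero_iff_ae_notMem]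
  filter_upwards [h2] with x hx hxAB
  have hx' : x ∈ (T Set.univ \ T A) ↔ x ∈ T B ∪ T (Aᶜ \ B) := iff_of_eq hx
  exact (hx'.2 (Or.inl hxAB.2)).2 hxAB.1

end IsRegularSetIso

namespace SetAction

variable {G : Type*} [Group G] {Ω : Type*} [MeasurableSpace Ω] {μ : Measure Ω}

/-- The measure `g_* μ`, given by `(g_* μ) A = μ (g⁻¹ A)`. -/
def push (α : SetAction G μ) (g : G) : Measure Ω :=
  Measure.ofMeasurable (fun A _ => μ (α.act g⁻¹ A)) (α.regular g⁻¹).measure_empty (by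
    intro A hA hd
    rw [measure_congr ((α.regular g⁻¹).iUnion A hA hd)]
    exact measure_iUnion₀
      (fun i j hij => (α.regular g⁻¹).aedisjoint (hA i) (hA j) (hd hij))
      (fun n => ((α.regular g⁻¹).measurableSet _ (hA n)).nullMeasurableSet))

theorem push_apply (α : SetAction G μ) (g : G) {A : Set Ω} (hA : MeasurableSet A) :
    α.push g A = μ (α.act g⁻¹ A) :=
  Measure.ofMeasurable_apply A hA

theorem push_absolutelyContinuous (α : SetAction G μ) (g : G) : α.push g ≪ μ :=
  Measure.AbsolutelyContinuous.mk fun A hA h => by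
    rw [push_apply α g hA]
    exact ((α.regular g⁻¹).null_iff A hA).2 h

instance (α : SetAction G μ) (g : G) [IsFiniteMeasure μ] : IsFiniteMeasure (α.push g) :=
  ⟨by rw [push_apply α g MeasurableSet.univ]; exact measure_lt_top _ _⟩

theorem push_act (α : SetAction G μ) (g : G) {A : Set Ω} (hA : MeasurableSet A) :
    α.push g (α.act g A) = μ A := by
  rw [push_apply α g ((α.regular g).measurableSet A hA)]
  have h := α.act_mul g⁻¹ g A hA
  rw [inv_mul_cancel] at h
  exact measure_congr (h.symm.trans (α.act_one A hA))

/-- The Radon–Nikodym derivative `d(g_* μ)/dμ`, as a real function. -/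
def density (α : SetAction G μ) (g : G) (ω : Ω) : ℝ :=
  ((α.push g).rnDeriv μ ω).toReal

theorem integrable_density (α : SetAction G μ) (g : G) [IsFiniteMeasure μ] :
    Integrable (α.density g) μ :=
  Measure.integrable_toReal_rnDeriv

open Classical in
/-- For measurable `A`, the element `(d(g_* μ)/dμ) χ_{gA}` of `L₁(μ)`. -/
def weighted (α : SetAction G μ) [IsFiniteMeasure μ] (g : G) (A : Set Ω) : Lp ℝ 1 μ :=
  if hA : MeasurableSet A then
    ((α.integrable_density g).indicator ((α.regular g).measurableSet A hA)).toL1 _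
  else 0

theorem norm_weighted (α : SetAction G μ) [IsFiniteMeasure μ] (g : G) {A : Set Ω}
    (hA : MeasurableSet A) : ‖α.weighted g A‖ = μ.real A := by
  have hgA := (α.regular g).measurableSet A hA
  rw [weighted, dif_pos hA, L1.norm_of_fun_eq_integral_norm]
  have : (fun ω => ‖(α.act g A).indicator (α.density g) ω‖)
      = (α.act g A).indicator (α.density g) := by
    funext ω
    rw [Real.norm_of_nonneg]
    exact Set.indicator_nonneg (fun _ _ => ENNReal.toReal_nonneg) _
  rw [this, integral_indicator hgA]
  change ∫ ω in α.act g A, ((α.push g).rnDeriv μ ω).toReal ∂μ = _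
  rw [Measure.setIntegral_toReal_rnDeriv (α.push_absolutelyContinuous g), Measure.real,
    α.push_act g hA, Measure.real]

theorem dominated_weighted (α : SetAction G μ) [IsFiniteMeasure μ] (g : G) :
    DominatedFinMeasAdditive μ
      (fun A => ContinuousLinearMap.toSpanSingleton ℝ (α.weighted g A)) 1 := by
  constructor
  · intro A B hA hB _ _ hd
    have key : α.weighted g (A ∪ B) = α.weighted g A + α.weighted g B := by
      have h1 := (α.regular g).union hA hB hd
      have h2 : ∀ᵐ x ∂μ, x ∉ α.act g A ∩ α.act g B :=
        measure_eq_zero_iff_ae_notMem.1 ((α.regular g).aedisjoint hA hB hd)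
      rw [weighted, weighted, weighted, dif_pos hA, dif_pos hB, dif_pos (hA.union hB),
        ← Integrable.toL1_add, Integrable.toL1_eq_toL1_iff]
      filter_upwards [h1, h2] with x hx hx2
      have hx' : x ∈ α.act g (A ∪ B) ↔ x ∈ α.act g A ∪ α.act g B := iff_of_eq hx
      by_cases ha : x ∈ α.act g A <;> by_cases hb : x ∈ α.act g B
      · exact (hx2 ⟨ha, hb⟩).elim
      all_goals
        simp_all [Set.indicator]
    ext
    simp [key]
  · intro A hA _
    simp [ContinuousLinearMap.norm_toSpanSingleton, α.norm_weighted g hA]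

/-- The operator `U_g` on `L₁(μ)` induced by the action: the bounded linear operator with
`U_g χ_A = (d(g_* μ)/dμ) χ_{gA}`. -/
def operator (α : SetAction G μ) [IsFiniteMeasure μ] (g : G) : Lp ℝ 1 μ →L[ℝ] Lp ℝ 1 μ :=
  L1.setToL1 (α.dominated_weighted g)

theorem operator_indicator (α : SetAction G μ) [IsFiniteMeasure μ] (g : G) {A : Set Ω}
    (hA : MeasurableSet A) :
    α.operator g (indicatorConstLp 1 hA (measure_ne_top μ A) 1) = α.weighted g A := by
  rw [operator, L1.setToL1_indicatorConstLp]
  simp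

/-- Continuity of the action: `g ↦ U_g` is continuous for the strong operator topology. -/
def IsContinuous [TopologicalSpace G] (α : SetAction G μ) [IsFiniteMeasure μ] : Prop :=
  ∀ f : Lp ℝ 1 μ, Continuous fun g : G => α.operator g f

end SetAction

/-! ### Point actions -/

/-- `G` acts on the set `Ω` by measurable bijections which preserve the measure class of `μ`. -/
structure IsPointAction (G : Type*) [Group G] {Ω : Type*} [MeasurableSpace Ω] [MulAction G Ω]
    (μ : Measure Ω) : Prop where
  measurable_smul : ∀ g : G, Measurable fun ω : Ω => g • ω
  map_absolutelyContinuous : ∀ g : G, μ.map (fun ω => g • ω) ≪ μ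
  absolutelyContinuous_map : ∀ g : G, μ ≪ μ.map (fun ω => g • ω)

namespace IsPointAction

variable {G : Type*} [Group G] {Ω : Type*} [MeasurableSpace Ω] [MulAction G Ω] {μ : Measure Ω}

theorem measurableSet_smul (h : IsPointAction G μ) (g : G) {A : Set Ω} (hA : MeasurableSet A) :
    MeasurableSet (g • A) := by
  rw [← Set.preimage_smul_inv]
  exact h.measurable_smul g⁻¹ hA

theorem measure_smul_eq_zero (h : IsPointAction G μ) (g : G) {A : Set Ω}
    (hA : MeasurableSet A) : μ (g • A) = 0 ↔ μ A = 0 := by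
  have e : μ (g • A) = μ.map (fun ω => g⁻¹ • ω) A := by
    rw [Measure.map_apply (h.measurable_smul g⁻¹) hA, ← Set.preimage_smul_inv]
  rw [e]
  exact ⟨fun h0 => h.absolutelyContinuous_map g⁻¹ h0,
    fun h0 => h.map_absolutelyContinuous g⁻¹ h0⟩

/-- The action by regular set isomorphisms induced by a point action: `(g, A) ↦ g • A`. -/
def setAction (h : IsPointAction G μ) : SetAction G μ where
  act g A := g • A
  regular g :=
    { measurableSet := fun _ hA => h.measurableSet_smul g hA
      congr := by
        intro A B hA hB hAB
        rw [ae_eq_set] at hAB ⊢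
        rw [← Set.smul_set_sdiff, ← Set.smul_set_sdiff, h.measure_smul_eq_zero g (hA.diff hB),
          h.measure_smul_eq_zero g (hB.diff hA)]
        exact hAB
      compl := by
        intro A _
        rw [← Set.smul_set_sdiff, Set.compl_eq_univ_sdiff]
        exact Filter.EventuallyEq.refl _ _
      iUnion := by
        intro A _ _
        rw [Set.smul_set_iUnion]
        exact Filter.EventuallyEq.refl _ _
      null_iff := fun _ hA => h.measure_smul_eq_zero g hA }
  act_one A _ := by
    rw [one_smul]
    exact Filter.EventuallyEq.refl _ _
  act_mul g k A _ := by
    rw [mul_smul]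
    exact Filter.EventuallyEq.refl _ _

end IsPointAction

/-- Property `𝓕` of a topological group `G`. -/
def PropertyF (G : Type u) [Group G] [TopologicalSpace G] : Prop :=
  ∃ (Ω : Type w) (_ : MeasurableSpace Ω) (_ : MulAction G Ω) (μ : Measure Ω)
    (_ : IsFiniteMeasure μ) (h : IsPointAction G μ),
    -- the induced action by regular set isomorphisms is continuous
    h.setAction.IsContinuous ∧
    -- the action is essentially free
    (∀ g : G, g ≠ 1 → μ {ω : Ω | g • ω = ω} = 0) ∧
    -- there is a measurable fundamental domain `F`
    ∃ F : Set Ω, MeasurableSet F ∧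
      μ (⋃ g : G, g • F)ᶜ = 0 ∧
      (∀ g h : G, g ≠ h → Disjoint (g • F) (h • F)) ∧
      -- the a.e. defined map sending the points of `g • F` to `g` is measurable,
      -- and nonempty open sets of `G` have preimages of positive measure
      ∀ V : Set G, IsOpen V →
        NullMeasurableSet (⋃ g ∈ V, g • F) μ ∧ (V.Nonempty → 0 < μ (⋃ g ∈ V, g • F))

/-! ### Vector measures, martingales and dentability -/

section Banach

variable {G : Type*} [Group G]
  {X : Type*} [NormedAddCommGroup X] [NormedSpace ℝ X] [DistribMulAction G X]
  {Ω : Type*} [MeasurableSpace Ω] {μ : Measure Ω} [IsFiniteMeasure μ]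

/-- `T` is the bounded operator `T_m : L₁(μ) → X` of the vector measure `m`. By density of the
simple functions there is at most one. -/
def IsOperatorOf (T : Lp ℝ 1 μ →L[ℝ] X) (m : VectorMeasure Ω X) : Prop :=
  ∀ (A : Set Ω) (hA : MeasurableSet A), T (indicatorConstLp 1 hA (measure_ne_top μ A) 1) = m A

/-- The vector measure `m` is `G`-quasi-invariant:
`g • m A = T_m ((d(g_* μ)/dμ) χ_{gA})` for all `g` and all measurable `A`. -/
def IsQuasiInvariant (α : SetAction G μ) (m : VectorMeasure Ω X) : Prop :=
  ∃ T : Lp ℝ 1 μ →L[ℝ] X, IsOperatorOf T m ∧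
    ∀ (g : G) (A : Set Ω), MeasurableSet A → g • m A = T (α.weighted g A)

/-- `f ∈ L₁(μ; X)` is `G`-equivariant-on-sets. (The integrability of `(d(g_* μ)/dμ) f`, needed for
the right-hand side to make sense, is automatic if `f` is essentially bounded.) -/
def IsEquivariantOnSets (α : SetAction G μ) (f : Ω → X) : Prop :=
  Integrable f μ ∧ ∀ g : G, Integrable (fun ω => α.density g ω • f ω) μ ∧
    ∀ A : Set Ω, MeasurableSet A →
      ∫ ω in A, g • f ω ∂μ = ∫ ω in α.act g A, α.density g ω • f ω ∂μ

/-- `M` is a `G`-equivariant-on-sets martingale: each `M n` is `G`-equivariant-on-sets and `M` is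
a martingale for a filtration of `G`-invariant sub-σ-algebras (invariance is understood modulo
null sets, since `g A` is only defined modulo null sets). -/
def IsEquivariantMartingale [CompleteSpace X] (α : SetAction G μ) (M : ℕ → Ω → X) : Prop :=
  (∀ n, IsEquivariantOnSets α (M n)) ∧
  ∃ 𝒜 : Filtration ℕ ‹MeasurableSpace Ω›,
    (∀ n (g : G) (A : Set Ω), MeasurableSet[𝒜 n] A →
      ∃ B : Set Ω, MeasurableSet[𝒜 n] B ∧ B =ᵐ[μ] α.act g A) ∧
    Martingale M 𝒜 μ

end Banach

/-- The `G`-Radon–Nikodym property of a `G`-Banach space `X`. -/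
def HasGRNP (G : Type u) [Group G] [TopologicalSpace G]
    (X : Type v) [NormedAddCommGroup X] [NormedSpace ℝ X] [DistribMulAction G X] : Prop :=
  ∀ (Ω : Type w) [MeasurableSpace Ω] (μ : Measure Ω) [IsFiniteMeasure μ] (α : SetAction G μ),
    α.IsContinuous →
    ∀ m : VectorMeasure Ω X, m.variation ≪ μ → IsQuasiInvariant α m →
      ∃ f : Ω → X, Integrable f μ ∧ ∀ A, MeasurableSet A → m A = ∫ ω in A, f ω ∂μ

/-- Every `X`-valued `G`-equivariant-on-sets martingale which is uniformly bounded in `L_∞`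
converges a.e. and in `L₁`. -/
def MartingalesConverge (G : Type u) [Group G] [TopologicalSpace G]
    (X : Type v) [NormedAddCommGroup X] [NormedSpace ℝ X] [CompleteSpace X]
    [DistribMulAction G X] : Prop :=
  ∀ (Ω : Type w) [MeasurableSpace Ω] (μ : Measure Ω) [IsFiniteMeasure μ] (α : SetAction G μ),
    α.IsContinuous →
    ∀ M : ℕ → Ω → X, IsEquivariantMartingale α M →
      (∃ C : ℝ, ∀ n, ∀ᵐ ω ∂μ, ‖M n ω‖ ≤ C) →
      ∃ f : Ω → X, Integrable f μ ∧
        (∀ᵐ ω ∂μ, Tendsto (fun n => M n ω) atTop (𝓝 (f ω))) ∧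
        Tendsto (fun n => eLpNorm (M n - f) 1 μ) atTop (𝓝 0)

/-- A set `C` is dentable: for every `ε > 0` some `x ∈ C` is not in the closed convex hull of
`C \ B(x, ε)`. -/
def IsDentable {X : Type*} [NormedAddCommGroup X] [NormedSpace ℝ X] (C : Set X) : Prop :=
  ∀ ε : ℝ, 0 < ε → ∃ x ∈ C, x ∉ closure (convexHull ℝ (C \ Metric.ball x ε))

/-- `X` is weakly `G`-dentable: every nonempty bounded `G`-invariant subset is dentable. -/
def IsWeaklyGDentable (G : Type*) [Group G] (X : Type*) [NormedAddCommGroup X]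
    [NormedSpace ℝ X] [DistribMulAction G X] : Prop :=
  ∀ C : Set X, C.Nonempty → Bornology.IsBounded C → (∀ g : G, g • C ⊆ C) → IsDentable C

end EquivRNP

end

/-!
The theorem combines the classical links between dentability, vector-valued densities and
martingales with three ways of bringing in the group.

*Dentability gives densities.* The group acts by linear isometries, so a denting point of the
saturation `⋃ g, g • C` of a bounded set can be moved into `C`; hence weak `G`-dentability already
makes every nonempty bounded set dentable (`IsWeaklyGDentable.isDentable`). For a vector measure
`m` with `‖m A‖ ≤ K μ A`, denting points of the sets of averages `m A / μ A` give, by exhaustion,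
countable partitions on whose cells `m` is uniformly close to multiples of `μ`; the corresponding
step functions converge to a density (`exists_density_of_isDentable`).

*Densities give convergence.* A bounded martingale `M` defines an operator `φ ↦ lim ∫ φ • M n ∂μ`
on `L₁(μ)`, the limit existing by Lévy's upward theorem, and the equivariance of the `M n` on sets
passes to it. If `f` is a density of its measure, then `M n` is the conditional expectation of
`f`, and Lévy's theorem for `f` (`tendsto_ae_condExp_of_banach`) gives the convergence.

*Convergence gives dentability, for groups with property `𝓕`.* If an invariant bounded set `C` is
not dentable, then, for some `ε > 0`, every point of `D = C + ball 0 1` is a finite convex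
combination of points of `D` at distance at least `ε / 2` from it. A random walk on `D` is then a
bounded divergent martingale `N n` on the sequence space `ℕ → [0, 1]` (`martingale_walk`). A
fundamental domain provides a map `γ : Ω → G` with `γ (g • ω) = g * γ ω`, so that `(ω, t) ↦ γ ω •
N n t` is an equivariant martingale on `Ω × (ℕ → [0, 1])` (`martingale_skew`), as divergent as `N
n`. Measurability is the delicate point: `γ` itself need not be measurable, but its compositions
with orbit maps are. Indeed, disjoint open subsets of `G` yield disjoint sets of positive measure,
so families of them are countable and the orbits in `X` are separable
(`exists_equivariant_map_to_group`).

*Locally compact σ-compact groups have property `𝓕`* (`propertyF_of_locallyCompact`): such a group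
acts by translations on itself, with a finite measure equivalent to Haar measure.
-/

namespace EquivRNP

/-! ### The Radon–Nikodym theorem in a space all of whose bounded sets are dentable -/

/-- Exhaustion: a property of measurable sets which is inherited by subsets, holds for null sets,
and holds for some non-null subset of every non-null set, holds for all cells of a countable
measurable partition. -/
theorem exists_countable_partition {Ω : Type*} [MeasurableSpace Ω] (μ : Measure Ω) [SFinite μ]
    (P : Set Ω → Prop) (hmono : ∀ A B, A ⊆ B → P B → P A) (hnull : ∀ N, μ N = 0 → P N)
    (hex : ∀ E, MeasurableSet E → μ E ≠ 0 → ∃ B ⊆ E, MeasurableSet B ∧ μ B ≠ 0 ∧ P B) :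
    ∃ κ : Ω → ℕ, Measurable κ ∧ ∀ k, P (κ ⁻¹' {k}) := by
  classical
  obtain ⟨D, hDC, hDc, hD⟩ := Measure.exists_ae_subset_biUnion_countable μ
    (C := {B | MeasurableSet B ∧ P B}) fun s hs => hs.1
  -- Adjoining `∅` to `D` makes it an enumerable nonempty family with the same union.
  obtain ⟨B, hB⟩ := (hDc.insert ∅).exists_eq_range (Set.insert_nonempty _ _)
  have hBm : ∀ n, MeasurableSet (B n) ∧ P (B n) := by
    intro n
    have : B n ∈ insert ∅ D := hB ▸ Set.mem_range_self n
    rcases this with h | h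
    · rw [h]; exact ⟨MeasurableSet.empty, hnull _ measure_empty⟩
    · exact hDC h
  have hU : ⋃₀ D = ⋃ n, B n := by
    rw [← Set.sUnion_range, ← hB, Set.sUnion_insert, Set.empty_union]
  have hcov : μ (⋃ n, B n)ᶜ = 0 := by
    by_contra hne
    obtain ⟨B', hB'E, hB'm, hB'0, hB'P⟩ := hex _ (MeasurableSet.iUnion fun n => (hBm n).1).compl hne
    have hle := hD B' ⟨hB'm, hB'P⟩
    rw [hU, ae_le_set] at hle
    rw [sdiff_eq_left.2 (Set.disjoint_left.2 fun x hx hx' => hB'E hx hx')] at hle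
    exact hB'0 hle
  -- The point `ω` is sent to the first `n + 1` with `ω ∈ B n`, and to `0` if there is none.
  let Q : Ω → ℕ → Prop := fun ω n => (n = 0 ∧ ∀ k, ω ∉ B k) ∨ ∃ k, n = k + 1 ∧ ω ∈ B k
  have hQ : ∀ ω, ∃ n, Q ω n := by
    intro ω
    by_cases h : ∀ k, ω ∉ B k
    · exact ⟨0, Or.inl ⟨rfl, h⟩⟩
    · push Not at h
      obtain ⟨k, hk⟩ := h
      exact ⟨k + 1, Or.inr ⟨k, rfl, hk⟩⟩
  refine ⟨fun ω => Nat.find (hQ ω), measurable_find hQ fun n => ?_, fun n => ?_⟩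
  · cases n with
    | zero =>
      have : {ω | Q ω 0} = (⋃ n, B n)ᶜ := by ext ω; simp [Q]
      rw [this]
      exact (MeasurableSet.iUnion fun n => (hBm n).1).compl
    | succ k =>
      have : {ω | Q ω (k + 1)} = B k := by ext ω; simp [Q]
      rw [this]
      exact (hBm k).1
  · cases n with
    | zero =>
      refine hnull _ (measure_mono_null ?_ hcov)
      intro ω hω
      have := Nat.find_spec (hQ ω)
      rw [Set.mem_preimage, Set.mem_singleton_iff] at hω
      rw [hω] at this
      simpa [Q] using this
    | succ k =>
      refine hmono _ _ ?_ (hBm k).2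
      intro ω hω
      have := Nat.find_spec (hQ ω)
      rw [Set.mem_preimage, Set.mem_singleton_iff] at hω
      rw [hω] at this
      simpa [Q] using this

section Banach

variable {Ω : Type*} [MeasurableSpace Ω] {μ : Measure Ω} [IsFiniteMeasure μ]
  {X : Type*} [NormedAddCommGroup X]

/-- A bound `‖v D‖ ≤ c μ(D)` for the subsets `D` of the cells of a countable partition holds for
all measurable sets. -/
theorem norm_le_of_forall_subset_partition (v : VectorMeasure Ω X) {c : ℝ} {κ : Ω → ℕ}
    (hκ : Measurable κ)
    (h : ∀ k, ∀ D ⊆ κ ⁻¹' {k}, MeasurableSet D → ‖v D‖ ≤ c * μ.real D)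
    {D : Set Ω} (hD : MeasurableSet D) : ‖v D‖ ≤ c * μ.real D := by
  have hm : ∀ k, MeasurableSet (D ∩ κ ⁻¹' {k}) := fun k => hD.inter (hκ (measurableSet_singleton k))
  have hd : Pairwise (Function.onFun Disjoint fun k => D ∩ κ ⁻¹' {k}) := by
    intro i j hij
    refine Set.disjoint_left.2 ?_
    rintro ω ⟨-, hi⟩ ⟨-, hj⟩
    exact hij (hi.symm.trans hj)
  have hU : (⋃ k, D ∩ κ ⁻¹' {k}) = D := by
    ext ω; simp
  have h1 := v.m_iUnion hm hd
  have h2 : HasSum (fun k => μ.real (D ∩ κ ⁻¹' {k})) (μ.real D) := by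
    have := μ.toSignedMeasure.m_iUnion hm hd
    simp only [hU] at this
    simpa [Measure.toSignedMeasure_apply_measurable, hm, hD] using this
  rw [hU] at h1
  exact h1.norm_le_of_bounded (h2.mul_left c) fun k => h k _ Set.inter_subset_right (hm k)

variable [NormedSpace ℝ X]

/-- If the averages of `m` over subsets of `E` form a dentable set, then `E` has a non-null subset
on which `m` is close to a multiple of `μ`: a half-space separating a denting point `y` from
the averages far away from it gives a signed measure, and a negative set of it will do. -/
theorem exists_subset_forall_norm_sub_le (m : VectorMeasure Ω X) {K : ℝ}
    (hm : ∀ A, MeasurableSet A → ‖m A‖ ≤ K * μ.real A)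
    (hdent : ∀ C : Set X, C.Nonempty → Bornology.IsBounded C → IsDentable C)
    {ε : ℝ} (hε : 0 < ε) {E : Set Ω} (hE : MeasurableSet E) (hμE : μ E ≠ 0) :
    ∃ B ⊆ E, MeasurableSet B ∧ μ B ≠ 0 ∧ ∃ y : X, ‖y‖ ≤ K ∧
      ∀ D ⊆ B, MeasurableSet D → ‖m D - μ.real D • y‖ ≤ ε * μ.real D := by
  have hpos : ∀ {A : Set Ω}, μ A ≠ 0 → 0 < μ.real A := fun h =>
    ENNReal.toReal_pos h (measure_ne_top _ _)
  let C : Set X := {x | ∃ A ⊆ E, MeasurableSet A ∧ μ A ≠ 0 ∧ x = (μ.real A)⁻¹ • m A}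
  have hnorm : ∀ x ∈ C, ‖x‖ ≤ K := by
    rintro _ ⟨A, -, hA, hμA, rfl⟩
    rw [norm_smul, norm_inv, Real.norm_of_nonneg measureReal_nonneg, inv_mul_le_iff₀ (hpos hμA),
      mul_comm]
    exact hm A hA
  have hCb : Bornology.IsBounded C := isBounded_iff_forall_norm_le.2 ⟨K, hnorm⟩
  obtain ⟨y, hyC, hy⟩ := hdent C ⟨_, E, subset_rfl, hE, hμE, rfl⟩ hCb ε hε
  obtain ⟨l, c, hlc, hcl⟩ :=
    geometric_hahn_banach_point_closed (convex_convexHull ℝ _).closure isClosed_closure hy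
  obtain ⟨A, hAE, hA, hμA, rfl⟩ := hyC
  -- the signed measure `l ∘ m - c μ`
  let s : SignedMeasure Ω :=
    m.mapRange (l : X →+ ℝ) l.continuous - c • μ.toSignedMeasure
  have hs : ∀ D, MeasurableSet D → s D = l (m D) - c * μ.real D := by
    intro D hD
    simp [s, hD, Measure.real]
    rfl
  have hsA : s A < 0 := by
    rw [hs A hA]
    rw [map_smul, smul_eq_mul, inv_mul_lt_iff₀ (hpos hμA)] at hlc
    linarith
  obtain ⟨B, hB, hBA, hBneg, hsB⟩ := SignedMeasure.exists_subset_restrict_nonpos hsA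
  refine ⟨B, hBA.trans hAE, hB, ?_, _, hnorm _ ⟨A, hAE, hA, hμA, rfl⟩, ?_⟩
  · intro h0
    have h1 : μ.real B = 0 := by simp [Measure.real, h0]
    have h2 : m B = 0 := by
      have := hm B hB
      rw [h1, mul_zero] at this
      exact norm_le_zero_iff.1 this
    rw [hs B hB, h1, h2] at hsB
    simp at hsB
  · intro D hDB hD
    by_cases hμD : μ D = 0
    · have h1 : μ.real D = 0 := by simp [Measure.real, hμD]
      have := hm D hD
      rw [h1, mul_zero] at this
      rw [norm_le_zero_iff.1 this, h1]
      simp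
    · have hle : s D ≤ 0 := by
        have := (VectorMeasure.restrict_le_restrict_iff _ _ hB).1 hBneg hD hDB
        simpa using this
      rw [hs D hD] at hle
      have hball : (μ.real D)⁻¹ • m D ∈ Metric.ball ((μ.real A)⁻¹ • m A) ε := by
        by_contra hnot
        have := hcl _ (subset_closure (subset_convexHull ℝ _
          ⟨⟨D, hDB.trans (hBA.trans hAE), hD, hμD, rfl⟩, hnot⟩))
        rw [map_smul, smul_eq_mul, lt_inv_mul_iff₀ (hpos hμD)] at this
        linarith
      rw [mem_ball_iff_norm] at hball
      have : m D - μ.real D • ((μ.real A)⁻¹ • m A)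
          = μ.real D • ((μ.real D)⁻¹ • m D - (μ.real A)⁻¹ • m A) := by
        rw [smul_sub, smul_inv_smul₀ (hpos hμD).ne']
      rw [this, norm_smul, Real.norm_of_nonneg measureReal_nonneg, mul_comm]
      exact mul_le_mul_of_nonneg_right hball.le measureReal_nonneg

/-- The Radon–Nikodym theorem for a vector measure with bounded average range, in a Banach space
all of whose bounded sets are dentable. -/
theorem exists_density_of_isDentable [CompleteSpace X] (m : VectorMeasure Ω X) {K : ℝ}
    (hm : ∀ A, MeasurableSet A → ‖m A‖ ≤ K * μ.real A)
    (hdent : ∀ C : Set X, C.Nonempty → Bornology.IsBounded C → IsDentable C) :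
    ∃ f : Ω → X, Integrable f μ ∧ ∀ A, MeasurableSet A → m A = ∫ ω in A, f ω ∂μ := by
  have hm0 : ∀ D, MeasurableSet D → μ.real D = 0 → m D = 0 := by
    intro D hD h0
    have := hm D hD
    rw [h0, mul_zero] at this
    exact norm_le_zero_iff.1 this
  rcases lt_or_ge K 0 with hK | hK
  · -- a negative bound forces `m = 0`
    refine ⟨0, integrable_zero _ _ _, fun A hA => ?_⟩
    have : m A = 0 := norm_le_zero_iff.1
      ((hm A hA).trans (mul_nonpos_of_nonpos_of_nonneg hK.le measureReal_nonneg))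
    simp [this]
  let ε : ℕ → ℝ := fun n => 1 / ((n : ℝ) + 1)
  have hεpos : ∀ n, 0 < ε n := fun n => Nat.one_div_pos_of_nat
  have hεlim : Tendsto ε atTop (𝓝 0) := tendsto_one_div_add_atTop_nhds_zero_nat
  -- For every `n`, a partition on whose cells `m` is `ε n`-close to multiples of `μ`.
  have key : ∀ n, ∃ κ : Ω → ℕ, Measurable κ ∧ ∀ k, ∃ y : X, ‖y‖ ≤ K ∧
      ∀ D ⊆ κ ⁻¹' {k}, MeasurableSet D → ‖m D - μ.real D • y‖ ≤ ε n * μ.real D := by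
    intro n
    refine exists_countable_partition μ (fun B => ∃ y : X, ‖y‖ ≤ K ∧
      ∀ D ⊆ B, MeasurableSet D → ‖m D - μ.real D • y‖ ≤ ε n * μ.real D) ?_ ?_ ?_
    · rintro A B hAB ⟨y, hy, h⟩
      exact ⟨y, hy, fun D hD => h D (hD.trans hAB)⟩
    · intro N hN
      refine ⟨0, by simpa using hK, fun D hDN hD => ?_⟩
      have h0 : μ.real D = 0 := by simp [Measure.real, measure_mono_null hDN hN]
      simp [h0, hm0 D hD h0]
    · intro E hE hμE
      exact exists_subset_forall_norm_sub_le m hm hdent (hεpos n) hE hμE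
  choose κ hκ y hy hmy using key
  let f : ℕ → Ω → X := fun n ω => y n (κ n ω)
  have hfm : ∀ n, StronglyMeasurable (f n) := fun n =>
    (StronglyMeasurable.of_discrete (f := y n)).comp_measurable (hκ n)
  -- Two cells that meet in a non-null set carry nearby values.
  have hcauchy : ∀ᵐ ω ∂μ, ∀ n n', ‖f n ω - f n' ω‖ ≤ ε n + ε n' := by
    rw [ae_all_iff]; intro n
    rw [ae_all_iff]; intro n'
    have hN : ∀ᵐ ω ∂μ, ∀ k k', μ (κ n ⁻¹' {k} ∩ κ n' ⁻¹' {k'}) = 0 →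
        ω ∉ κ n ⁻¹' {k} ∩ κ n' ⁻¹' {k'} := by
      rw [ae_all_iff]; intro k
      rw [ae_all_iff]; intro k'
      by_cases h : μ (κ n ⁻¹' {k} ∩ κ n' ⁻¹' {k'}) = 0
      · filter_upwards [measure_eq_zero_iff_ae_notMem.1 h] with ω hω _ using hω
      · exact Eventually.of_forall fun ω h' => (h h').elim
    filter_upwards [hN] with ω hω
    set D := κ n ⁻¹' {κ n ω} ∩ κ n' ⁻¹' {κ n' ω}
    have hDm : MeasurableSet D := (hκ n (measurableSet_singleton _)).inter
      (hκ n' (measurableSet_singleton _))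
    have hD0 : 0 < μ.real D := ENNReal.toReal_pos
      (fun h => hω _ _ h ⟨rfl, rfl⟩) (measure_ne_top _ _)
    have h1 := hmy n (κ n ω) D Set.inter_subset_left hDm
    have h2 := hmy n' (κ n' ω) D Set.inter_subset_right hDm
    have h3 : ‖μ.real D • (f n ω - f n' ω)‖ ≤ (ε n + ε n') * μ.real D := by
      have : μ.real D • (f n ω - f n' ω)
          = (m D - μ.real D • y n' (κ n' ω)) - (m D - μ.real D • y n (κ n ω)) := by
        simp only [f, smul_sub]; abel
      rw [this]
      refine (norm_sub_le _ _).trans ?_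
      linarith
    rw [norm_smul, Real.norm_of_nonneg hD0.le, mul_comm] at h3
    exact le_of_mul_le_mul_right h3 hD0
  have hlim : ∀ᵐ ω ∂μ, ∃ z, Tendsto (fun n => f n ω) atTop (𝓝 z) := by
    filter_upwards [hcauchy] with ω hω
    refine cauchySeq_tendsto_of_complete (Metric.cauchySeq_iff'.2 fun δ hδ => ?_)
    obtain ⟨N, hN⟩ := eventually_atTop.1 (hεlim.eventually (gt_mem_nhds (half_pos hδ)))
    refine ⟨N, fun n hn => ?_⟩
    rw [dist_eq_norm]
    have := hω n N
    have h1 := hN n hn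
    have h2 := hN N le_rfl
    linarith
  obtain ⟨F, hF, hFlim⟩ := exists_stronglyMeasurable_limit_of_tendsto_ae
    (fun n => (hfm n).aestronglyMeasurable) hlim
  have hFf : ∀ᵐ ω ∂μ, ∀ n, ‖f n ω - F ω‖ ≤ ε n := by
    filter_upwards [hcauchy, hFlim] with ω h1 h2 n
    have h3 : Tendsto (fun n' => ‖f n ω - f n' ω‖) atTop (𝓝 ‖f n ω - F ω‖) :=
      (tendsto_const_nhds.sub h2).norm
    have h4 : Tendsto (fun n' => ε n + ε n') atTop (𝓝 (ε n + 0)) :=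
      tendsto_const_nhds.add hεlim
    rw [add_zero] at h4
    exact le_of_tendsto_of_tendsto' h3 h4 (h1 n)
  have hFint : Integrable F μ := by
    refine Integrable.of_bound hF.aestronglyMeasurable K ?_
    filter_upwards [hFlim] with ω hω
    exact le_of_tendsto' hω.norm fun n => hy n _
  refine ⟨F, hFint, fun A hA => ?_⟩
  have hbound : ∀ n, ‖m A - ∫ ω in A, F ω ∂μ‖ ≤ (2 * ε n) * μ.real A := by
    intro n
    have := norm_le_of_forall_subset_partition (m - μ.withDensityᵥ F) (μ := μ) (c := 2 * ε n)
      (hκ n) ?_ hA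
    · rwa [_root_.sub_apply, withDensityᵥ_apply hFint hA] at this
    · intro k D hDk hD
      rw [_root_.sub_apply, withDensityᵥ_apply hFint hD]
      have h1 := hmy n k D hDk hD
      have h2 : ‖∫ ω in D, (y n k - F ω) ∂μ‖ ≤ ε n * μ.real D := by
        refine norm_setIntegral_le_of_norm_le_const_ae' (measure_lt_top _ _) ?_
        filter_upwards [hFf] with ω hω hωD
        have : κ n ω = k := hDk hωD
        simpa only [f, this] using hω n
      rw [integral_sub (integrable_const _) hFint.integrableOn, setIntegral_const] at h2
      have : m D - ∫ ω in D, F ω ∂μ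
          = (m D - μ.real D • y n k) + (μ.real D • y n k - ∫ ω in D, F ω ∂μ) := by abel
      rw [this]
      refine (norm_add_le _ _).trans ?_
      linarith
  have hz : Tendsto (fun n => (2 * ε n) * μ.real A) atTop (𝓝 ((2 * 0) * μ.real A)) :=
    (hεlim.const_mul 2).mul_const _
  rw [mul_zero, zero_mul] at hz
  exact sub_eq_zero.1 (norm_le_zero_iff.1 (ge_of_tendsto' hz hbound))

end Banach

/-! ### Weak `G`-dentability and dentability of bounded sets -/

theorem norm_group_smul {G X : Type*} [Group G] [NormedAddCommGroup X] [DistribMulAction G X]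
    [IsIsometricSMul G X] (g : G) (x : X) : ‖g • x‖ = ‖x‖ := by
  rw [← dist_zero_right, ← smul_zero g, dist_smul, dist_zero_right]

section Dentable

variable {G : Type*} [Group G] {X : Type*} [NormedAddCommGroup X] [NormedSpace ℝ X]
  [DistribMulAction G X] [SMulCommClass G ℝ X] [IsIsometricSMul G X]

/-- If the saturation `⋃ g, g • C` is dentable, so is `C`: a denting point of the saturation can be
moved into `C`, because the group acts by linear isometries. -/
theorem isDentable_of_iUnion_smul {C : Set X} (h : IsDentable (⋃ g : G, g • C)) :
    IsDentable C := by
  intro ε hε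
  obtain ⟨x, hx, hxε⟩ := h ε hε
  obtain ⟨g, y, hy, rfl⟩ := Set.mem_iUnion.1 hx
  refine ⟨y, hy, fun hcl => hxε ?_⟩
  let L : X →ₗ[ℝ] X :=
    { toFun := fun z => g • z
      map_add' := smul_add g
      map_smul' := fun r z => smul_comm g r z }
  have hcont : Continuous L := (isometry_smul X g).continuous
  have h1 : L y ∈ closure (L '' convexHull ℝ (C \ Metric.ball y ε)) :=
    image_closure_subset_closure_image hcont ⟨y, hcl, rfl⟩
  rw [L.isLinear.image_convexHull] at h1
  refine closure_mono (convexHull_mono ?_) h1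
  rintro _ ⟨z, ⟨hzC, hzb⟩, rfl⟩
  refine ⟨Set.mem_iUnion.2 ⟨g, z, hzC, rfl⟩, fun hb => hzb ?_⟩
  have : dist (g • z) (g • y) < ε := hb
  rwa [dist_smul] at this

/-- A weakly `G`-dentable space has all its nonempty bounded subsets dentable. -/
theorem IsWeaklyGDentable.isDentable (h : IsWeaklyGDentable G X) {C : Set X} (hC : C.Nonempty)
    (hb : Bornology.IsBounded C) : IsDentable C := by
  refine isDentable_of_iUnion_smul (G := G) (h _ ?_ ?_ ?_)
  · obtain ⟨x, hx⟩ := hC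
    exact ⟨_, Set.mem_iUnion.2 ⟨1, x, hx, rfl⟩⟩
  · obtain ⟨R, hR⟩ := isBounded_iff_forall_norm_le.1 hb
    refine isBounded_iff_forall_norm_le.2 ⟨R, fun z hz => ?_⟩
    obtain ⟨g, x, hx, rfl⟩ := Set.mem_iUnion.1 hz
    change ‖g • x‖ ≤ R
    rw [norm_group_smul]
    exact hR x hx
  · intro g
    rw [Set.smul_set_iUnion]
    refine Set.iUnion_subset fun k => ?_
    rw [smul_smul]
    exact Set.subset_iUnion (fun k : G => k • C) (g * k)

end Dentable

theorem IsWeaklyGDentable.hasGRNP (G : Type u) [Group G] [TopologicalSpace G]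
    (X : Type v) [NormedAddCommGroup X] [NormedSpace ℝ X] [CompleteSpace X]
    [DistribMulAction G X] [SMulCommClass G ℝ X] [IsIsometricSMul G X]
    (h : IsWeaklyGDentable G X) : HasGRNP.{u, v, w} G X := by
  rintro Ω _ μ _ α - m - ⟨T, hT, -⟩
  refine exists_density_of_isDentable m (K := ‖T‖) (fun A hA => ?_)
    fun C hC hb => h.isDentable hC hb
  rw [← hT A hA]
  refine (T.le_opNorm _).trans ?_
  rw [norm_indicatorConstLp one_ne_zero ENNReal.one_ne_top]
  simp

/-! ### Bounded martingales and their limit operators -/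

section Martingale

variable {Ω : Type*} [mΩ : MeasurableSpace Ω] {μ : Measure Ω}
  {X : Type*} [NormedAddCommGroup X] [NormedSpace ℝ X]

/-- The operator `φ ↦ ∫ φ g dμ` on `L₁(μ)` given by an essentially bounded function `g`. -/
theorem exists_clm_integral_smul {g : Ω → X} (hg : AEStronglyMeasurable g μ) {C : ℝ}
    (hC : ∀ᵐ ω ∂μ, ‖g ω‖ ≤ C) :
    ∃ T : Lp ℝ 1 μ →L[ℝ] X, ∀ φ : Lp ℝ 1 μ, T φ = ∫ ω, φ ω • g ω ∂μ := by
  have hint : ∀ φ : Lp ℝ 1 μ, Integrable (fun ω => φ ω • g ω) μ := fun φ =>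
    (L1.integrable_coeFn φ).smul_bdd C hg hC
  let L : Lp ℝ 1 μ →ₗ[ℝ] X :=
    { toFun := fun φ => ∫ ω, φ ω • g ω ∂μ
      map_add' := by
        intro φ ψ
        rw [← integral_add (hint φ) (hint ψ)]
        refine integral_congr_ae ?_
        filter_upwards [Lp.coeFn_add φ ψ] with ω hω
        rw [hω, Pi.add_apply, add_smul]
      map_smul' := by
        intro r φ
        rw [RingHom.id_apply, ← integral_smul]
        refine integral_congr_ae ?_
        filter_upwards [Lp.coeFn_smul r φ] with ω hω
        rw [hω, Pi.smul_apply, smul_eq_mul, mul_smul] }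
  refine ⟨L.mkContinuous C fun φ => ?_, fun φ => rfl⟩
  calc ‖∫ ω, φ ω • g ω ∂μ‖ ≤ ∫ ω, C * ‖φ ω‖ ∂μ := by
        refine norm_integral_le_of_norm_le ((L1.integrable_coeFn φ).norm.const_mul C) ?_
        filter_upwards [hC] with ω hω
        rw [norm_smul, mul_comm]
        exact mul_le_mul_of_nonneg_right hω (norm_nonneg _)
    _ = C * ‖φ‖ := by rw [integral_const_mul, L1.norm_eq_integral_norm]

variable [IsFiniteMeasure μ] [CompleteSpace X]

/-- Lévy's upward theorem, almost everywhere, for functions with values in a Banach space. It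
follows from the scalar theorem applied to the functions `‖f - x‖`, with `x` in a countable dense
set of values. -/
theorem tendsto_ae_condExp_of_banach (𝒜 : Filtration ℕ mΩ) (f : Ω → X) :
    ∀ᵐ ω ∂μ, Tendsto (fun n => (μ[f | 𝒜 n]) ω) atTop (𝓝 ((μ[f | ⨆ n, 𝒜 n]) ω)) := by
  have hle : ⨆ n, 𝒜 n ≤ mΩ := iSup_le fun n => 𝒜.le n
  set F := μ[f | ⨆ n, 𝒜 n]
  have hFm : StronglyMeasurable[⨆ n, 𝒜 n] F := stronglyMeasurable_condExp
  have hFint : Integrable F μ := integrable_condExp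
  obtain ⟨c, hc, hcF⟩ := hFm.isSeparable_range
  have h1 : ∀ᵐ ω ∂μ, ∀ n, (μ[F | 𝒜 n]) ω = (μ[f | 𝒜 n]) ω := ae_all_iff.2 fun n =>
    condExp_condExp_of_le (le_iSup _ n) hle
  have h2 : ∀ᵐ ω ∂μ, ∀ x ∈ c, Tendsto (fun n => (μ[fun ω => ‖F ω - x‖ | 𝒜 n]) ω) atTop
      (𝓝 ‖F ω - x‖) := by
    refine (ae_ball_iff hc).2 fun x _ => ?_
    have hm : StronglyMeasurable[⨆ n, 𝒜 n] fun ω => ‖F ω - x‖ :=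
      (hFm.sub stronglyMeasurable_const).norm
    exact Integrable.tendsto_ae_condExp (hFint.sub (integrable_const x)).norm hm
  have h3 : ∀ᵐ ω ∂μ, ∀ x ∈ c, ∀ n,
      ‖(μ[F | 𝒜 n]) ω - x‖ ≤ (μ[fun ω => ‖F ω - x‖ | 𝒜 n]) ω := by
    refine (ae_ball_iff hc).2 fun x _ => ae_all_iff.2 fun n => ?_
    have e1 : μ[fun ω => F ω - x | 𝒜 n] =ᵐ[μ] μ[F | 𝒜 n] - μ[fun _ => x | 𝒜 n] :=
      condExp_sub hFint (integrable_const x) _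
    rw [condExp_const (𝒜.le n)] at e1
    filter_upwards [e1, norm_condExp_le (μ := μ) (m := 𝒜 n) fun ω => F ω - x] with ω hω hω'
    rw [hω] at hω'
    exact hω'
  filter_upwards [h1, h2, h3] with ω h1 h2 h3
  refine Metric.tendsto_atTop.2 fun ε hε => ?_
  obtain ⟨x, hxc, hx⟩ := Metric.mem_closure_iff.1 (hcF ⟨ω, rfl⟩) (ε / 2) (half_pos hε)
  rw [dist_eq_norm] at hx
  obtain ⟨N, hN⟩ := eventually_atTop.1 ((h2 x hxc).eventually (gt_mem_nhds hx))
  refine ⟨N, fun n hn => ?_⟩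
  have h4 := (h3 x hxc n).trans_lt (hN n hn)
  rw [← h1 n, dist_eq_norm]
  calc ‖(μ[F | 𝒜 n]) ω - F ω‖ = ‖((μ[F | 𝒜 n]) ω - x) - (F ω - x)‖ := by congr 1; abel
    _ ≤ ‖(μ[F | 𝒜 n]) ω - x‖ + ‖F ω - x‖ := norm_sub_le _ _
    _ < ε := by linarith

/-- The integrals of a bounded martingale against a fixed integrable function converge: the
function may be replaced by its conditional expectations, which converge in `L₁`. -/
theorem cauchySeq_integral_smul_martingale {𝒜 : Filtration ℕ mΩ} {M : ℕ → Ω → X}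
    (hM : Martingale M 𝒜 μ) {C : ℝ} (hC : ∀ n, ∀ᵐ ω ∂μ, ‖M n ω‖ ≤ C) {φ : Ω → ℝ}
    (hφ : Integrable φ μ) : CauchySeq fun n => ∫ ω, φ ω • M n ω ∂μ := by
  have hMm : ∀ n, AEStronglyMeasurable (M n) μ := fun n =>
    ((hM.1 n).mono (𝒜.le n)).aestronglyMeasurable
  have hMint : ∀ n, Integrable (M n) μ := fun n => Integrable.of_bound (hMm n) C (hC n)
  let φ' : ℕ → Ω → ℝ := fun n => μ[φ | 𝒜 n]
  have hφ' : ∀ n, Integrable (φ' n) μ := fun n => integrable_condExp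
  have e1 : ∀ n, ∫ ω, φ ω • M n ω ∂μ = ∫ ω, φ' n ω • M n ω ∂μ := by
    intro n
    have : μ[φ • M n | 𝒜 n] =ᵐ[μ] μ[φ | 𝒜 n] • M n :=
      condExp_smul_of_aestronglyMeasurable_right hφ
        (hφ.smul_bdd C (hMm n) (hC n)) (hM.1 n).aestronglyMeasurable
    calc ∫ ω, φ ω • M n ω ∂μ = ∫ ω, (μ[φ • M n | 𝒜 n]) ω ∂μ := (integral_condExp (𝒜.le n)).symm
      _ = _ := integral_congr_ae this
  have e2 : ∀ k n, k ≤ n → ∫ ω, φ' k ω • M n ω ∂μ = ∫ ω, φ' k ω • M k ω ∂μ := by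
    intro k n hkn
    have : μ[φ' k • M n | 𝒜 k] =ᵐ[μ] φ' k • μ[M n | 𝒜 k] :=
      condExp_smul_of_aestronglyMeasurable_left stronglyMeasurable_condExp.aestronglyMeasurable
        ((hφ' k).smul_bdd C (hMm n) (hC n)) (hMint n)
    calc ∫ ω, φ' k ω • M n ω ∂μ = ∫ ω, (μ[φ' k • M n | 𝒜 k]) ω ∂μ :=
          (integral_condExp (𝒜.le k)).symm
      _ = _ := integral_congr_ae (this.trans (by
          filter_upwards [hM.2 k n hkn] with ω hω
          simp [hω]))
  set ψ := μ[φ | ⨆ n, 𝒜 n]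
  have hψint : Integrable ψ μ := integrable_condExp
  have hlim : Tendsto (fun n => C * ∫ ω, ‖φ' n ω - ψ ω‖ ∂μ) atTop (𝓝 0) := by
    have h := tendsto_eLpNorm_condExp (μ := μ) (ℱ := 𝒜) φ
    have h' := (ENNReal.tendsto_toReal ENNReal.zero_ne_top).comp h
    rw [ENNReal.toReal_zero] at h'
    have h'' := h'.const_mul C
    rw [mul_zero] at h''
    refine h''.congr fun n => ?_
    rw [Function.comp_apply, eLpNorm_one_eq_lintegral_enorm]
    exact congrArg (C * ·)
      (integral_norm_eq_lintegral_enorm ((hφ' n).sub hψint).aestronglyMeasurable).symm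
  refine Metric.cauchySeq_iff'.2 fun ε hε => ?_
  obtain ⟨N, hN⟩ := eventually_atTop.1 (hlim.eventually (gt_mem_nhds (half_pos hε)))
  refine ⟨N, fun n hn => ?_⟩
  have e3 : ∫ ω, φ ω • M n ω ∂μ - ∫ ω, φ ω • M N ω ∂μ
      = ∫ ω, (φ' n ω - φ' N ω) • M n ω ∂μ := by
    rw [e1 n, e1 N, ← e2 N n hn]
    simp_rw [sub_smul]
    exact (integral_sub ((hφ' n).smul_bdd C (hMm n) (hC n))
      ((hφ' N).smul_bdd C (hMm n) (hC n))).symm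
  rw [dist_eq_norm, e3]
  have hi : ∀ k, Integrable (fun ω => ‖φ' k ω - ψ ω‖) μ := fun k => ((hφ' k).sub hψint).norm
  calc ‖∫ ω, (φ' n ω - φ' N ω) • M n ω ∂μ‖
      ≤ ∫ ω, C * (‖φ' n ω - ψ ω‖ + ‖φ' N ω - ψ ω‖) ∂μ := by
        refine norm_integral_le_of_norm_le (((hi n).add (hi N)).const_mul C) ?_
        filter_upwards [hC n] with ω hω
        rw [norm_smul, mul_comm]
        have hC0 : 0 ≤ C := (norm_nonneg _).trans hω
        have htri : ‖φ' n ω - φ' N ω‖ ≤ ‖φ' n ω - ψ ω‖ + ‖φ' N ω - ψ ω‖ := by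
          have := norm_sub_le (φ' n ω - ψ ω) (φ' N ω - ψ ω)
          rwa [sub_sub_sub_cancel_right] at this
        exact mul_le_mul hω htri (norm_nonneg _) hC0
    _ = C * ∫ ω, ‖φ' n ω - ψ ω‖ ∂μ + C * ∫ ω, ‖φ' N ω - ψ ω‖ ∂μ := by
        rw [integral_const_mul, integral_add (hi n) (hi N), mul_add]
    _ < ε := by
        have h1 := hN n hn
        have h2 := hN N le_rfl
        linarith

/-- A bounded martingale defines a bounded operator on `L₁(μ)`. -/
theorem exists_clm_tendsto_integral_smul_martingale {𝒜 : Filtration ℕ mΩ} {M : ℕ → Ω → X}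
    (hM : Martingale M 𝒜 μ) {C : ℝ} (hC : ∀ n, ∀ᵐ ω ∂μ, ‖M n ω‖ ≤ C) :
    ∃ T : Lp ℝ 1 μ →L[ℝ] X, ∀ φ : Lp ℝ 1 μ,
      Tendsto (fun n => ∫ ω, φ ω • M n ω ∂μ) atTop (𝓝 (T φ)) := by
  choose S hS using fun n => exists_clm_integral_smul
    ((hM.1 n).mono (𝒜.le n)).aestronglyMeasurable (hC n)
  choose T hT using fun φ : Lp ℝ 1 μ => cauchySeq_tendsto_of_complete
    (cauchySeq_integral_smul_martingale hM hC (L1.integrable_coeFn φ))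
  have hlim : Tendsto (fun n φ => S n φ) atTop (𝓝 T) :=
    tendsto_pi_nhds.2 fun φ => by simpa only [hS] using hT φ
  exact ⟨continuousLinearMapOfTendsto S hlim, hT⟩

end Martingale

section OperatorMeasure

variable {Ω : Type*} [MeasurableSpace Ω] {μ : Measure Ω} [IsFiniteMeasure μ]
  {X : Type*} [NormedAddCommGroup X] [NormedSpace ℝ X]

/-- Every bounded operator on `L₁(μ)` is the operator of a vector measure, whose variation is
absolutely continuous with respect to `μ`. -/
theorem exists_vectorMeasure_isOperatorOf (T : Lp ℝ 1 μ →L[ℝ] X) :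
    ∃ m : VectorMeasure Ω X, m.variation ≪ μ ∧ IsOperatorOf T m := by
  classical
  let m₀ : Set Ω → X := fun A =>
    if hA : MeasurableSet A then T (indicatorConstLp 1 hA (measure_ne_top μ A) 1) else 0
  have hm₀ : ∀ A, ‖m₀ A‖ₑ ≤ (‖T‖₊ • μ) A := by
    intro A
    by_cases hA : MeasurableSet A
    · simp only [m₀, dif_pos hA]
      rw [Measure.smul_apply, ← ofReal_norm]
      calc ENNReal.ofReal ‖T (indicatorConstLp 1 hA (measure_ne_top μ A) 1)‖
          ≤ ENNReal.ofReal (‖T‖ * μ.real A) := by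
            refine ENNReal.ofReal_le_ofReal ((T.le_opNorm _).trans_eq ?_)
            rw [norm_indicatorConstLp one_ne_zero ENNReal.one_ne_top]
            simp
        _ = _ := by
            rw [ENNReal.ofReal_mul (norm_nonneg _), ofReal_measureReal, ENNReal.smul_def,
              smul_eq_mul]
            congr 1
            exact ofReal_norm T
    · simp [m₀, dif_neg hA]
  let m : VectorMeasure Ω X := VectorMeasure.of_additive_of_le_measure m₀ hm₀
    (fun A B hA hB hAB => by
      simp only [m₀, dif_pos hA, dif_pos hB, dif_pos (hA.union hB)]
      rw [← map_add, indicatorConstLp_disjoint_union hA hB (measure_ne_top μ A)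
        (measure_ne_top μ B) hAB])
    (fun A hA => dif_neg hA)
  refine ⟨m, ?_, fun A hA => ?_⟩
  · have hle : m.variation ≤ ‖T‖₊ • μ :=
      VectorMeasure.variation_le_of_forall_enorm_le fun A _ => hm₀ A
    exact (Measure.absolutelyContinuous_of_le hle).trans Measure.smul_absolutelyContinuous
  · change _ = m₀ A
    simp only [m₀, dif_pos hA]

end OperatorMeasure

/-! ### The equivariant Radon–Nikodym property implies convergence of bounded martingales -/

/-- The limit operator of a bounded equivariant martingale is represented by a density, of which the
martingale consists of the conditional expectations. -/
theorem HasGRNP.martingalesConverge (G : Type u) [Group G] [TopologicalSpace G]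
    (X : Type v) [NormedAddCommGroup X] [NormedSpace ℝ X] [CompleteSpace X]
    [DistribMulAction G X] [SMulCommClass G ℝ X] [IsIsometricSMul G X]
    (h : HasGRNP.{u, v, w} G X) : MartingalesConverge.{u, v, w} G X := by
  rintro Ω _ μ _ α hα M ⟨hMeq, 𝒜, -, hM⟩ ⟨C, hC⟩
  obtain ⟨T, hT⟩ := exists_clm_tendsto_integral_smul_martingale hM hC
  obtain ⟨m, hmμ, hTm⟩ := exists_vectorMeasure_isOperatorOf T
  have hMm : ∀ n, AEStronglyMeasurable (M n) μ := fun n =>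
    ((hM.1 n).mono (𝒜.le n)).aestronglyMeasurable
  have hmlim : ∀ A, MeasurableSet A → Tendsto (fun n => ∫ ω in A, M n ω ∂μ) atTop (𝓝 (m A)) := by
    intro A hA
    rw [← hTm A hA]
    refine (hT _).congr fun n => ?_
    rw [← integral_indicator hA]
    refine integral_congr_ae ?_
    filter_upwards [indicatorConstLp_coeFn (p := 1) (hs := hA) (hμs := measure_ne_top μ A)
      (c := (1 : ℝ))] with ω hω
    rw [hω]
    by_cases hωA : ω ∈ A <;> simp [hωA]
  have hquasi : IsQuasiInvariant α m := by
    refine ⟨T, hTm, fun g A hA => ?_⟩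
    have hgA := (α.regular g).measurableSet A hA
    have h1 : Tendsto (fun n => ∫ ω in α.act g A, α.density g ω • M n ω ∂μ) atTop
        (𝓝 (T (α.weighted g A))) := by
      refine (hT _).congr fun n => ?_
      rw [← integral_indicator hgA]
      refine integral_congr_ae ?_
      rw [SetAction.weighted, dif_pos hA]
      filter_upwards [Integrable.coeFn_toL1 ((α.integrable_density g).indicator hgA)] with ω hω
      rw [hω]
      by_cases hωA : ω ∈ α.act g A <;> simp [hωA]
    have h2 : Tendsto (fun n => g • ∫ ω in A, M n ω ∂μ) atTop (𝓝 (g • m A)) :=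
      ((isometry_smul X g).continuous.tendsto _).comp (hmlim A hA)
    refine tendsto_nhds_unique (h2.congr fun n => ?_) h1
    rw [← ((hMeq n).2 g).2 A hA]
    let L : X →L[ℝ] X :=
      { toFun := fun z => g • z
        map_add' := smul_add g
        map_smul' := fun r z => smul_comm g r z
        cont := (isometry_smul X g).continuous }
    exact (L.integral_comp_comm (hMeq n).1.integrableOn).symm
  obtain ⟨f, hf, hmf⟩ := h Ω μ α hα m hmμ hquasi
  have hMf : ∀ k, M k =ᵐ[μ] μ[f | 𝒜 k] := by
    intro k
    refine ae_eq_condExp_of_forall_setIntegral_eq (𝒜.le k) hf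
      (fun A _ _ => (hMeq k).1.integrableOn) (fun A hA _ => ?_) (hM.1 k).aestronglyMeasurable
    rw [← hmf A (𝒜.le k A hA)]
    refine tendsto_nhds_unique (tendsto_const_nhds.congr' ?_) (hmlim A (𝒜.le k A hA))
    filter_upwards [eventually_ge_atTop k] with n hn
    rw [← setIntegral_condExp (𝒜.le k) (hMeq n).1 hA]
    refine setIntegral_congr_ae (𝒜.le k A hA) ?_
    filter_upwards [hM.2 k n hn] with ω hω _ using hω.symm
  have hlim : ∀ᵐ ω ∂μ, Tendsto (fun n => M n ω) atTop (𝓝 ((μ[f | ⨆ n, 𝒜 n]) ω)) := by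
    filter_upwards [tendsto_ae_condExp_of_banach 𝒜 f, ae_all_iff.2 hMf] with ω h1 h2
    simpa only [h2] using h1
  refine ⟨μ[f | ⨆ n, 𝒜 n], integrable_condExp, hlim, ?_⟩
  have := tendsto_lintegral_norm_of_dominated_convergence (bound := fun _ => C) hMm
    (hasFiniteIntegral_const C) hC hlim
  refine this.congr fun n => ?_
  rw [eLpNorm_one_eq_lintegral_enorm]
  simp_rw [ofReal_norm]
  rfl

/-! ### Criteria for the continuity of an action -/

namespace SetAction

variable {G : Type*} [Group G] {Ω : Type*} [mΩ : MeasurableSpace Ω] {μ : Measure Ω}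
  [IsFiniteMeasure μ]

theorem weighted_union (α : SetAction G μ) (g : G) {A B : Set Ω} (hA : MeasurableSet A)
    (hB : MeasurableSet B) (hAB : Disjoint A B) :
    α.weighted g (A ∪ B) = α.weighted g A + α.weighted g B := by
  have h := (α.dominated_weighted g).1 A B hA hB (measure_ne_top _ _) (measure_ne_top _ _) hAB
  simpa using congrArg (fun L : ℝ →L[ℝ] Lp ℝ 1 μ => L 1) h

theorem norm_operator_le (α : SetAction G μ) (g : G) : ‖α.operator g‖ ≤ 1 :=
  L1.norm_setToL1_le _ zero_le_one

theorem weighted_eq_toL1 (α : SetAction G μ) (g : G) {A : Set Ω} (hA : MeasurableSet A) :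
    α.weighted g A =
      ((α.integrable_density g).indicator ((α.regular g).measurableSet A hA)).toL1 _ :=
  dif_pos hA

theorem dist_weighted (α : SetAction G μ) (g k : G) {A : Set Ω} (hA : MeasurableSet A) :
    dist (α.weighted g A) (α.weighted k A) =
      ∫ ω, ‖(α.act g A).indicator (α.density g) ω - (α.act k A).indicator (α.density k) ω‖ ∂μ := by
  rw [dist_eq_norm, α.weighted_eq_toL1 g hA, α.weighted_eq_toL1 k hA, ← Integrable.toL1_sub,
    L1.norm_of_fun_eq_integral_norm]
  rfl

variable [TopologicalSpace G]

/-- The operators of an action are contractions, so that continuity needs to be checked on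
indicator functions only. -/
theorem isContinuous_of_continuous_weighted (α : SetAction G μ)
    (h : ∀ A, MeasurableSet A → Continuous fun g => α.weighted g A) : α.IsContinuous := by
  intro f
  refine Lp.induction ENNReal.one_ne_top (fun f => Continuous fun g => α.operator g f)
    ?_ ?_ ?_ f
  · intro c s hs hμs
    have e : ∀ g, α.operator g (Lp.simpleFunc.indicatorConst 1 hs hμs.ne c : Lp ℝ 1 μ)
        = c • α.weighted g s := by
      intro g
      have : (Lp.simpleFunc.indicatorConst 1 hs hμs.ne c : Lp ℝ 1 μ)
          = c • indicatorConstLp 1 hs (measure_ne_top μ s) (1 : ℝ) := by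
        rw [Lp.simpleFunc.coe_indicatorConst, indicatorConstLp, indicatorConstLp,
          ← MemLp.toLp_const_smul]
        congr 1
        ext ω
        by_cases hω : ω ∈ s <;> simp [hω]
      rw [this, map_smul, α.operator_indicator g hs]
    simp_rw [e]
    exact (h s hs).const_smul c
  · intro f f' hf hf' _ h1 h2
    simp_rw [map_add]
    exact h1.add h2
  · refine isClosed_of_closure_subset fun f hf => ?_
    refine continuous_of_uniform_approx_of_continuous fun U hU => ?_
    obtain ⟨ε, hε, hεU⟩ := Metric.mem_uniformity_dist.1 hU
    obtain ⟨f', hf', hd⟩ := Metric.mem_closure_iff.1 hf ε hε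
    refine ⟨fun g => α.operator g f', hf', fun g => hεU ?_⟩
    rw [dist_eq_norm, ← map_sub]
    calc ‖α.operator g (f - f')‖ ≤ 1 * ‖f - f'‖ :=
          (α.operator g).le_of_opNorm_le (α.norm_operator_le g) _
      _ < ε := by rwa [one_mul, ← dist_eq_norm]

/-- Continuity of an action may be checked on a generating `π`-system containing the whole
space. -/
theorem isContinuous_of_generateFrom (α : SetAction G μ) {S : Set (Set Ω)}
    (hS : mΩ = MeasurableSpace.generateFrom S) (hpi : IsPiSystem S) (huniv : Set.univ ∈ S)
    (h : ∀ A ∈ S, Continuous fun g => α.weighted g A) : α.IsContinuous := by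
  have hempty : ∀ g, α.weighted g ∅ = 0 := by
    intro g
    rw [← norm_eq_zero, α.norm_weighted g MeasurableSet.empty]
    simp
  refine α.isContinuous_of_continuous_weighted fun A hA => ?_
  induction A, hA using MeasurableSpace.induction_on_inter hS hpi with
  | empty =>
    simp_rw [hempty]
    exact continuous_const
  | basic A hA => exact h A hA
  | compl A hA ih =>
    have e : ∀ g, α.weighted g Aᶜ = α.weighted g Set.univ - α.weighted g A := by
      intro g
      rw [← Set.union_compl_self A, α.weighted_union g hA hA.compl disjoint_compl_right,
        add_sub_cancel_left]
    simp_rw [e]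
    exact (h _ huniv).sub ih
  | iUnion A hd hA ih =>
    -- The finite unions of the `A i` exhaust their union uniformly in `g`.
    let B : ℕ → Set Ω := fun n => ⋃ i ∈ Finset.range n, A i
    have hB : ∀ n, MeasurableSet (B n) := fun n =>
      Finset.measurableSet_biUnion _ fun i _ => hA i
    have hBc : ∀ n, Continuous fun g => α.weighted g (B n) := by
      intro n
      induction n with
      | zero =>
        have : B 0 = ∅ := by simp [B]
        simp_rw [this, hempty]
        exact continuous_const
      | succ n ihn =>
        have e : B (n + 1) = B n ∪ A n := by
          simp only [B, Finset.range_add_one, Finset.set_biUnion_insert]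
          exact Set.union_comm _ _
        have hdn : Disjoint (B n) (A n) := by
          simp only [B, Set.disjoint_iUnion_left]
          intro i hi
          exact hd (Finset.mem_range.1 hi).ne
        have e' : ∀ g, α.weighted g (B (n + 1)) = α.weighted g (B n) + α.weighted g (A n) := by
          intro g
          rw [e, α.weighted_union g (hB n) (hA n) hdn]
        simp_rw [e']
        exact ihn.add (ih n)
    have hU : MeasurableSet (⋃ i, A i) := MeasurableSet.iUnion hA
    have hBU : ∀ n, B n ⊆ ⋃ i, A i := fun n => Set.iUnion₂_subset fun i _ => Set.subset_iUnion A i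
    have hlim : Tendsto (fun n => μ.real ((⋃ i, A i) \ B n)) atTop (𝓝 0) := by
      have hanti : Antitone fun n => (⋃ i, A i) \ B n := by
        intro n k hnk
        refine Set.sdiff_subset_sdiff_right ?_
        exact Set.biUnion_subset_biUnion_left (Finset.range_mono hnk)
      have h1 := tendsto_measure_iInter_atTop (μ := μ)
        (fun n => (hU.diff (hB n)).nullMeasurableSet) hanti ⟨0, measure_ne_top _ _⟩
      have h2 : (⋂ n, (⋃ i, A i) \ B n) = ∅ := by
        refine Set.eq_empty_of_forall_notMem fun ω hω => ?_
        rw [Set.mem_iInter] at hω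
        obtain ⟨i, hi⟩ := Set.mem_iUnion.1 (hω 0).1
        exact (hω (i + 1)).2 (Set.mem_biUnion (Finset.mem_coe.2 (Finset.self_mem_range_succ i)) hi)
      rw [h2, measure_empty] at h1
      exact (ENNReal.tendsto_toReal ENNReal.zero_ne_top).comp h1
    refine continuous_of_uniform_approx_of_continuous fun U hUU => ?_
    obtain ⟨ε, hε, hεU⟩ := Metric.mem_uniformity_dist.1 hUU
    obtain ⟨n, hn⟩ := (hlim.eventually (gt_mem_nhds hε)).exists
    refine ⟨_, hBc n, fun g => hεU ?_⟩
    have e : α.weighted g (⋃ i, A i) = α.weighted g (B n) + α.weighted g ((⋃ i, A i) \ B n) := by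
      rw [← α.weighted_union g (hB n) (hU.diff (hB n)) Set.disjoint_sdiff_right,
        Set.union_sdiff_cancel (hBU n)]
    rw [dist_eq_norm, e, add_sub_cancel_left, α.norm_weighted g (hU.diff (hB n))]
    exact hn

end SetAction

/-! ### Point actions, and their products with a probability space -/

namespace IsPointAction

variable {G : Type*} [Group G] {Ω : Type*} [MeasurableSpace Ω] [MulAction G Ω] {μ : Measure Ω}

theorem push_setAction (h : IsPointAction G μ) (g : G) :
    h.setAction.push g = μ.map fun ω => g • ω := by
  ext A hA
  rw [SetAction.push_apply _ g hA, Measure.map_apply (h.measurable_smul g) hA,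
    Set.preimage_smul]
  rfl

/-- A bounded function which is equivariant almost everywhere is equivariant on sets. -/
theorem isEquivariantOnSets [IsFiniteMeasure μ] {X : Type*} [NormedAddCommGroup X]
    [NormedSpace ℝ X] [DistribMulAction G X] (h : IsPointAction G μ) {f : Ω → X}
    (hf : AEStronglyMeasurable f μ) {C : ℝ} (hC : ∀ᵐ ω ∂μ, ‖f ω‖ ≤ C)
    (heq : ∀ g : G, ∀ᵐ ω ∂μ, f (g • ω) = g • f ω) : IsEquivariantOnSets h.setAction f := by
  refine ⟨Integrable.of_bound hf C hC, fun g =>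
    ⟨(h.setAction.integrable_density g).smul_bdd C hf hC, fun A hA => ?_⟩⟩
  have hgA : MeasurableSet (g • A) := h.measurableSet_smul g hA
  calc ∫ ω in A, g • f ω ∂μ = ∫ ω in A, f (g • ω) ∂μ := by
        refine setIntegral_congr_ae hA ?_
        filter_upwards [heq g] with ω hω _ using hω.symm
    _ = ∫ ω in (fun ω => g • ω) ⁻¹' (g • A), f (g • ω) ∂μ := by
        rw [Set.preimage_smul, inv_smul_smul]
    _ = ∫ ω in g • A, f ω ∂(μ.map fun ω => g • ω) :=
        (setIntegral_map hgA (hf.mono_ac (h.map_absolutelyContinuous g))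
          (h.measurable_smul g).aemeasurable).symm
    _ = ∫ ω in g • A, f ω ∂(h.setAction.push g) := by rw [h.push_setAction]
    _ = ∫ ω in h.setAction.act g A, h.setAction.density g ω • f ω ∂μ :=
        (setIntegral_rnDeriv_smul (h.setAction.push_absolutelyContinuous g) hgA).symm

section Prod

variable {T : Type*} [MeasurableSpace T] [MulAction G T] {ν : Measure T}
  [IsFiniteMeasure μ]

theorem map_smul_prod [IsFiniteMeasure ν] (h : IsPointAction G μ)
    (hT : ∀ (g : G) (t : T), g • t = t) (g : G) :
    (μ.prod ν).map (fun p => g • p) = (μ.map fun ω => g • ω).prod ν := by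
  have e : (fun p : Ω × T => g • p) = Prod.map (fun ω => g • ω) id := by
    ext p
    · rfl
    · exact hT g p.2
  rw [e, ← Measure.map_prod_map μ ν (h.measurable_smul g) measurable_id, Measure.map_id]

/-- The product of a point action with a trivial action. -/
theorem prod_of_trivial [IsFiniteMeasure ν] (h : IsPointAction G μ)
    (hT : ∀ (g : G) (t : T), g • t = t) : IsPointAction G (μ.prod ν) where
  measurable_smul g := by
    have e : (fun p : Ω × T => g • p) = Prod.map (fun ω => g • ω) id := by
      ext p
      · rfl
      · exact hT g p.2
    rw [e]
    exact (h.measurable_smul g).prodMap measurable_id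
  map_absolutelyContinuous g := by
    rw [h.map_smul_prod hT]
    exact (h.map_absolutelyContinuous g).prod Measure.AbsolutelyContinuous.rfl
  absolutelyContinuous_map g := by
    rw [h.map_smul_prod hT]
    exact (h.absolutelyContinuous_map g).prod Measure.AbsolutelyContinuous.rfl

theorem density_prod [IsFiniteMeasure ν] (h : IsPointAction G μ)
    (hT : ∀ (g : G) (t : T), g • t = t) (h' : IsPointAction G (μ.prod ν)) (g : G) :
    h'.setAction.density g =ᵐ[μ.prod ν] fun p => h.setAction.density g p.1 := by
  have hm : Measurable ((h.setAction.push g).rnDeriv μ) := Measure.measurable_rnDeriv _ _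
  have e : h'.setAction.push g
      = (μ.prod ν).withDensity fun p => (h.setAction.push g).rnDeriv μ p.1 := by
    rw [h'.push_setAction, h.map_smul_prod hT, ← prod_withDensity_left hm,
      Measure.withDensity_rnDeriv_eq _ _ (h.setAction.push_absolutelyContinuous g),
      h.push_setAction]
  have h1 := Measure.rnDeriv_withDensity (μ.prod ν) (hm.comp measurable_fst)
  rw [show (μ.prod ν).withDensity ((h.setAction.push g).rnDeriv μ ∘ Prod.fst)
    = h'.setAction.push g from e.symm] at h1
  filter_upwards [h1] with p hp
  rw [SetAction.density, hp]
  rfl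

/-- Continuity of a point action passes to its product with a trivial action on a probability
space: on rectangles `A ×ˢ B` the orbit maps of the product are no less continuous than those
of `A`. -/
theorem isContinuous_prod_of_trivial [TopologicalSpace G] [IsProbabilityMeasure ν]
    (h : IsPointAction G μ) (hT : ∀ (g : G) (t : T), g • t = t)
    (h' : IsPointAction G (μ.prod ν)) (hc : h.setAction.IsContinuous) :
    h'.setAction.IsContinuous := by
  refine h'.setAction.isContinuous_of_generateFrom generateFrom_prod.symm isPiSystem_prod
    ⟨Set.univ, MeasurableSet.univ, Set.univ, MeasurableSet.univ, Set.univ_prod_univ⟩ ?_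
  rintro _ ⟨A, hA, B, hB, rfl⟩
  have hA' : MeasurableSet A := hA
  have hB' : MeasurableSet B := hB
  have hAB := hA'.prod hB'
  have hcA : Continuous fun g => h.setAction.weighted g A := by
    simp_rw [← h.setAction.operator_indicator _ hA']
    exact hc _
  have hact : ∀ g : G, h'.setAction.act g (A ×ˢ B) = (g • A) ×ˢ B := by
    intro g
    have : g • B = B := by
      have : (fun t : T => g • t) = id := funext (hT g)
      rw [← Set.image_smul, this, Set.image_id]
    change g • (A ×ˢ B) = _
    rw [Set.smul_set_prod, this]
  have hle : ∀ g k, dist (h'.setAction.weighted g (A ×ˢ B)) (h'.setAction.weighted k (A ×ˢ B))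
      ≤ dist (h.setAction.weighted g A) (h.setAction.weighted k A) := by
    intro g k
    rw [SetAction.dist_weighted _ g k hAB, SetAction.dist_weighted _ g k hA']
    set F : Ω → ℝ := fun ω => ‖(h.setAction.act g A).indicator (h.setAction.density g) ω
      - (h.setAction.act k A).indicator (h.setAction.density k) ω‖
    have hFint : Integrable F μ :=
      (((h.setAction.integrable_density g).indicator (h.measurableSet_smul g hA')).sub
        ((h.setAction.integrable_density k).indicator (h.measurableSet_smul k hA'))).norm
    have e : ∫ ω, F ω ∂μ = ∫ p, F p.1 ∂(μ.prod ν) := by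
      rw [integral_fun_fst]; simp
    rw [e]
    refine integral_mono_ae ?_ (hFint.comp_fst ν) ?_
    · exact (((h'.setAction.integrable_density g).indicator (h'.measurableSet_smul g hAB)).sub
        ((h'.setAction.integrable_density k).indicator (h'.measurableSet_smul k hAB))).norm
    · filter_upwards [h.density_prod hT h' g, h.density_prod hT h' k] with p hg hk
      rw [hact g, hact k]
      by_cases hpB : p.2 ∈ B
      · have e1 : ∀ j : G, h'.setAction.density j p = h.setAction.density j p.1 →
            ((j • A) ×ˢ B).indicator (h'.setAction.density j) p
              = (h.setAction.act j A).indicator (h.setAction.density j) p.1 := by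
          intro j hj
          by_cases hpA : p.1 ∈ h.setAction.act j A
          · have hp : p ∈ (j • A) ×ˢ B := ⟨hpA, hpB⟩
            rw [Set.indicator_of_mem hpA, Set.indicator_of_mem hp, hj]
          · rw [Set.indicator_of_notMem hpA, Set.indicator_of_notMem fun hp => hpA hp.1]
        rw [e1 g hg, e1 k hk]
      · have e1 : ∀ j : G, p ∉ (j • A) ×ˢ B := fun j hp => hpB hp.2
        rw [Set.indicator_of_notMem (e1 g), Set.indicator_of_notMem (e1 k), sub_zero, norm_zero]
        exact norm_nonneg _
  refine continuous_iff_continuousAt.2 fun k => tendsto_iff_dist_tendsto_zero.2 ?_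
  exact squeeze_zero (fun _ => dist_nonneg) (fun g => hle g k)
    (tendsto_iff_dist_tendsto_zero.1 (hcA.tendsto k))

end Prod

end IsPointAction

/-! ### Locally compact σ-compact groups have property `𝓕` -/

/-- The left translations act continuously on `L₁` of a Haar measure. -/
theorem tendsto_integral_norm_translate_sub {G : Type*} [Group G] [TopologicalSpace G]
    [IsTopologicalGroup G] [LocallyCompactSpace G] [MeasurableSpace G] [BorelSpace G]
    (ρ : Measure G) [ρ.IsMulLeftInvariant] [ρ.Regular] {f : G → ℝ}
    (hf : Integrable f ρ) (k : G) :
    Tendsto (fun g : G => ∫ x, ‖f (g⁻¹ * x) - f (k⁻¹ * x)‖ ∂ρ) (𝓝 k) (𝓝 0) := by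
  have : Fact ((1 : ℝ≥0∞) ≠ ∞) := ⟨ENNReal.one_ne_top⟩
  have hcont : Continuous fun g : G => DomMulAct.mk g⁻¹ • hf.toL1 f :=
    (DomMulAct.continuous_mk.comp continuous_inv).smul continuous_const
  refine (tendsto_iff_dist_tendsto_zero.1 (hcont.tendsto k)).congr fun g => ?_
  have hae : ∀ j : G, (DomMulAct.mk j⁻¹ • hf.toL1 f : Lp ℝ 1 ρ) =ᵐ[ρ] fun x => f (j⁻¹ * x) := by
    intro j
    refine (DomMulAct.smul_Lp_ae_eq _ _).trans ?_
    exact (measurePreserving_mul_left ρ j⁻¹).quasiMeasurePreserving.ae_eq_comp hf.coeFn_toL1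
  rw [dist_eq_norm, L1.norm_eq_integral_norm]
  refine integral_congr_ae ?_
  filter_upwards [Lp.coeFn_sub (DomMulAct.mk g⁻¹ • hf.toL1 f) (DomMulAct.mk k⁻¹ • hf.toL1 f),
    hae g, hae k] with x h1 h2 h3
  rw [h1, Pi.sub_apply, h2, h3]

section Translation

variable {G : Type u} [MeasurableSpace G] (ρ : Measure G) (q : G → NNReal)

/-- The measure with density `q` with respect to `ρ`, transported to a copy of `G` in a larger
universe. -/
noncomputable def liftedMeasure : Measure (ULift.{w} G) :=
  (ρ.withDensity fun x => (q x : ℝ≥0∞)).map ULift.up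

variable {ρ q}

theorem lintegral_liftedMeasure (hq : Measurable q) {f : ULift.{w} G → ℝ≥0∞} (hf : Measurable f) :
    ∫⁻ ω, f ω ∂(liftedMeasure.{u, w} ρ q) = ∫⁻ x, q x * f ⟨x⟩ ∂ρ := by
  rw [liftedMeasure, lintegral_map hf measurable_up,
    lintegral_withDensity_eq_lintegral_mul _ hq.coe_nnreal_ennreal
      (show Measurable fun x => f (ULift.up x) from hf.comp measurable_up)]
  rfl

theorem liftedMeasure_eq_zero_iff (hq : Measurable q) (hq0 : ∀ x, 0 < q x) {A : Set (ULift.{w} G)}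
    (hA : MeasurableSet A) : liftedMeasure.{u, w} ρ q A = 0 ↔ ρ (ULift.up ⁻¹' A) = 0 := by
  rw [liftedMeasure, Measure.map_apply measurable_up hA]
  refine ⟨fun h => ?_, fun h => withDensity_absolutelyContinuous _ _ h⟩
  refine withDensity_absolutelyContinuous' hq.coe_nnreal_ennreal.aemeasurable
    (Eventually.of_forall fun x => ?_) h
  exact_mod_cast (hq0 x).ne'

variable [Group G] [TopologicalSpace G] [IsTopologicalGroup G] [BorelSpace G]
  [ρ.IsMulLeftInvariant]

theorem isPointAction_liftedMeasure (hq : Measurable q) (hq0 : ∀ x, 0 < q x) :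
    IsPointAction G (liftedMeasure.{u, w} ρ q) := by
  have hm : ∀ g : G, Measurable fun ω : ULift.{w} G => g • ω := fun g =>
    measurable_up.comp ((measurable_const_mul g).comp measurable_down)
  have key : ∀ (g : G) {A : Set (ULift.{w} G)}, MeasurableSet A →
      ((liftedMeasure.{u, w} ρ q).map (fun ω => g • ω) A = 0 ↔ liftedMeasure.{u, w} ρ q A = 0) := by
    intro g A hA
    rw [Measure.map_apply (hm g) hA, liftedMeasure_eq_zero_iff hq hq0 (hm g hA),
      liftedMeasure_eq_zero_iff hq hq0 hA]
    have : ULift.up ⁻¹' ((fun ω : ULift.{w} G => g • ω) ⁻¹' A)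
        = (fun x => g * x) ⁻¹' (ULift.up ⁻¹' A) := rfl
    rw [this, measure_preimage_mul]
  exact
    { measurable_smul := hm
      map_absolutelyContinuous := fun g =>
        Measure.AbsolutelyContinuous.mk fun A hA h => (key g hA).2 h
      absolutelyContinuous_map := fun g =>
        Measure.AbsolutelyContinuous.mk fun A hA h => (key g hA).1 h }

theorem density_liftedMeasure [IsFiniteMeasure (liftedMeasure.{u, w} ρ q)]
    (hq : Measurable q) (hq0 : ∀ x, 0 < q x)
    (h : IsPointAction G (liftedMeasure.{u, w} ρ q)) (g : G) :
    h.setAction.density g =ᵐ[liftedMeasure.{u, w} ρ q]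
      fun ω => (q (g⁻¹ * ω.down) : ℝ) / q ω.down := by
  let r : ULift.{w} G → ℝ≥0∞ := fun ω => (q (g⁻¹ * ω.down) / q ω.down : NNReal)
  have hr : Measurable r :=
    ((hq.comp ((measurable_const_mul g⁻¹).comp measurable_down)).div
      (hq.comp measurable_down)).coe_nnreal_ennreal
  have e : h.setAction.push g = (liftedMeasure.{u, w} ρ q).withDensity r := by
    rw [h.push_setAction]
    ext A hA
    have hgA := h.measurable_smul g hA
    rw [Measure.map_apply (h.measurable_smul g) hA, withDensity_apply _ hA,
      ← lintegral_indicator hA, lintegral_liftedMeasure hq (hr.indicator hA),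
      ← lintegral_indicator_one hgA,
      lintegral_liftedMeasure hq (measurable_one.indicator hgA),
      ← lintegral_mul_left_eq_self _ g⁻¹]
    refine lintegral_congr fun x => ?_
    by_cases hx : (⟨x⟩ : ULift.{w} G) ∈ A
    · have hx' : (⟨g⁻¹ * x⟩ : ULift.{w} G) ∈ (fun ω : ULift.{w} G => g • ω) ⁻¹' A := by
        change (⟨g * (g⁻¹ * x)⟩ : ULift.{w} G) ∈ A
        rwa [mul_inv_cancel_left]
      rw [Set.indicator_of_mem hx, Set.indicator_of_mem hx', Pi.one_apply, mul_one,
        ← ENNReal.coe_mul]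
      congr 1
      exact (mul_div_cancel₀ _ (hq0 x).ne').symm
    · have hx' : (⟨g⁻¹ * x⟩ : ULift.{w} G) ∉ (fun ω : ULift.{w} G => g • ω) ⁻¹' A := by
        change (⟨g * (g⁻¹ * x)⟩ : ULift.{w} G) ∉ A
        rwa [mul_inv_cancel_left]
      rw [Set.indicator_of_notMem hx, Set.indicator_of_notMem hx', mul_zero, mul_zero]
  have h1 := Measure.rnDeriv_withDensity (liftedMeasure.{u, w} ρ q) hr
  rw [← e] at h1
  filter_upwards [h1] with ω hω
  rw [SetAction.density, hω]
  simp [r]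

/-- In terms of the invariant measure `ρ`, the operators of the translation action on `L₁(q ρ)`
are the translation operators of `L₁(ρ)`. -/
theorem isContinuous_liftedMeasure [LocallyCompactSpace G] [ρ.Regular]
    [IsFiniteMeasure (liftedMeasure.{u, w} ρ q)] (hq : Measurable q) (hq0 : ∀ x, 0 < q x)
    (hqi : Integrable (fun x => (q x : ℝ)) ρ)
    (h : IsPointAction G (liftedMeasure.{u, w} ρ q)) : h.setAction.IsContinuous := by
  refine h.setAction.isContinuous_of_continuous_weighted fun A hA => ?_
  have hA' : MeasurableSet (ULift.up ⁻¹' A : Set G) := measurable_up hA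
  let f : G → ℝ := (ULift.up ⁻¹' A : Set G).indicator fun x => (q x : ℝ)
  have hf : Integrable f ρ := hqi.indicator hA'
  have hfm : Measurable f := (hq.coe_nnreal_real).indicator hA'
  refine continuous_iff_continuousAt.2 fun k => tendsto_iff_dist_tendsto_zero.2 ?_
  refine (tendsto_integral_norm_translate_sub ρ hf k).congr fun g => ?_
  rw [SetAction.dist_weighted _ g k hA]
  have hae : ∀ j : G, (h.setAction.act j A).indicator (h.setAction.density j)
      =ᵐ[liftedMeasure.{u, w} ρ q] fun ω => f (j⁻¹ * ω.down) / q ω.down := by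
    intro j
    filter_upwards [density_liftedMeasure hq hq0 h j] with ω hω
    have hiff : ω ∈ h.setAction.act j A ↔ j⁻¹ * ω.down ∈ (ULift.up ⁻¹' A : Set G) := by
      change ω ∈ j • A ↔ _
      rw [Set.mem_smul_set_iff_inv_smul_mem]
      rfl
    by_cases hωA : ω ∈ h.setAction.act j A
    · rw [Set.indicator_of_mem hωA, hω]
      simp only [f]
      rw [Set.indicator_of_mem (hiff.1 hωA)]
    · rw [Set.indicator_of_notMem hωA]
      simp only [f]
      rw [Set.indicator_of_notMem fun h' => hωA (hiff.2 h'), zero_div]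
  have hmeas : Measurable fun ω : ULift.{w} G =>
      ‖f (g⁻¹ * ω.down) / q ω.down - f (k⁻¹ * ω.down) / q ω.down‖ₑ := by
    have hj : ∀ j : G, Measurable fun ω : ULift.{w} G => f (j⁻¹ * ω.down) / (q ω.down : ℝ) :=
      fun j => (hfm.comp ((measurable_const_mul j⁻¹).comp measurable_down)).div
        (hq.coe_nnreal_real.comp measurable_down)
    exact ((hj g).sub (hj k)).enorm
  calc ∫ x, ‖f (g⁻¹ * x) - f (k⁻¹ * x)‖ ∂ρ
      = (∫⁻ x, ‖f (g⁻¹ * x) - f (k⁻¹ * x)‖ₑ ∂ρ).toReal :=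
        integral_norm_eq_lintegral_enorm
          ((hfm.comp (measurable_const_mul _)).sub
            (hfm.comp (measurable_const_mul _))).aestronglyMeasurable
    _ = (∫⁻ ω, ‖f (g⁻¹ * ω.down) / q ω.down - f (k⁻¹ * ω.down) / q ω.down‖ₑ
          ∂(liftedMeasure.{u, w} ρ q)).toReal := by
        rw [lintegral_liftedMeasure hq hmeas]
        congr 1
        refine lintegral_congr fun x => ?_
        have hqx : (q x : ℝ) ≠ 0 := by exact_mod_cast (hq0 x).ne'
        have e1 : (q x : ℝ≥0∞) = ‖(q x : ℝ)‖ₑ := by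
          rw [Real.enorm_eq_ofReal (q x).coe_nonneg, ENNReal.ofReal_coe_nnreal]
        rw [e1, ← enorm_mul, mul_sub, mul_div_cancel₀ _ hqx, mul_div_cancel₀ _ hqx]
    _ = (∫⁻ ω, ‖(h.setAction.act g A).indicator (h.setAction.density g) ω
          - (h.setAction.act k A).indicator (h.setAction.density k) ω‖ₑ
          ∂(liftedMeasure.{u, w} ρ q)).toReal := by
        congr 1
        refine lintegral_congr_ae ?_
        filter_upwards [hae g, hae k] with ω h1 h2
        rw [h1, h2]
    _ = _ := by
        refine (integral_norm_eq_lintegral_enorm ?_).symm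
        exact (((h.setAction.integrable_density g).indicator (h.measurableSet_smul g hA)).sub
          ((h.setAction.integrable_density k).indicator
            (h.measurableSet_smul k hA))).aestronglyMeasurable

end Translation

/-- The group acts by translations on itself, with a finite measure equivalent to Haar measure;
a single point is a fundamental domain. -/
theorem propertyF_of_locallyCompact (G : Type u) [Group G] [TopologicalSpace G]
    [IsTopologicalGroup G] [T2Space G] [LocallyCompactSpace G] [SigmaCompactSpace G] :
    PropertyF.{u, max u w} G := by
  borelize G
  let ρ : Measure G := Measure.haar
  obtain ⟨q, hq0, hq, hqlt⟩ := exists_pos_lintegral_lt_of_sigmaFinite ρ one_ne_zero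
  have hqi : Integrable (fun x => (q x : ℝ)) ρ := by
    refine ⟨hq.coe_nnreal_real.aestronglyMeasurable, ?_⟩
    rw [HasFiniteIntegral]
    refine lt_of_eq_of_lt ?_ (hqlt.trans ENNReal.one_lt_top)
    refine lintegral_congr fun x => ?_
    rw [Real.enorm_eq_ofReal (q x).coe_nonneg, ENNReal.ofReal_coe_nnreal]
  have hfin : IsFiniteMeasure (liftedMeasure.{u, w} ρ q) := by
    refine ⟨?_⟩
    rw [← lintegral_one, lintegral_liftedMeasure hq measurable_const]
    simpa using hqlt.trans ENNReal.one_lt_top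
  have h := isPointAction_liftedMeasure.{u, w} (ρ := ρ) hq hq0
  have hU : ∀ V : Set G, (⋃ g ∈ V, g • ({⟨1⟩} : Set (ULift.{w} G))) = ULift.down ⁻¹' V := by
    intro V
    ext ω
    simp only [Set.smul_set_singleton, Set.mem_iUnion, Set.mem_singleton_iff, Set.mem_preimage,
      exists_prop]
    constructor
    · rintro ⟨g, hg, rfl⟩
      change g * 1 ∈ V
      rwa [mul_one]
    · intro hω
      exact ⟨ω.down, hω, congrArg ULift.up (mul_one ω.down).symm⟩
  refine ⟨ULift.{w} G, inferInstance, inferInstance, liftedMeasure.{u, w} ρ q, hfin, h,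
    isContinuous_liftedMeasure hq hq0 hqi h, fun g hg => ?_, {⟨1⟩}, ?_, ?_, fun g k hgk => ?_,
    fun V hV => ⟨?_, fun hne => ?_⟩⟩
  · have : {ω : ULift.{w} G | g • ω = ω} = ∅ := by
      refine Set.eq_empty_of_forall_notMem fun ω hω => hg ?_
      exact mul_eq_right.1 (congrArg ULift.down hω)
    rw [this, measure_empty]
  · have : ({⟨1⟩} : Set (ULift.{w} G)) = ULift.down ⁻¹' {1} := by
      ext ω
      exact ⟨fun h => congrArg ULift.down h, fun h => congrArg ULift.up h⟩
    rw [this]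
    exact measurable_down (measurableSet_singleton 1)
  · have := hU Set.univ
    simp only [Set.mem_univ, Set.iUnion_true, Set.preimage_univ] at this
    rw [this, Set.compl_univ, measure_empty]
  · rw [Set.smul_set_singleton, Set.smul_set_singleton, Set.disjoint_singleton]
    intro he
    exact hgk (mul_right_cancel (congrArg ULift.down he))
  · rw [hU]
    exact (measurable_down hV.measurableSet).nullMeasurableSet
  · rw [hU, pos_iff_ne_zero]
    intro h0
    rw [liftedMeasure_eq_zero_iff hq hq0 (measurable_down hV.measurableSet)] at h0
    exact (hV.measure_pos ρ hne).ne' h0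

/-! ### A bounded martingale with large increments in a set without denting points -/

section Splitting

variable {X : Type*} [NormedAddCommGroup X] [NormedSpace ℝ X]

/-- Adding the open unit ball to a set without `ε`-denting points turns the approximation of its
points by convex combinations into equality. -/
theorem mem_convexHull_diff_ball_of_add_ball {C : Set X} {ε : ℝ} (hε : 0 < ε)
    (hC : ∀ x ∈ C, x ∈ closure (convexHull ℝ (C \ Metric.ball x ε))) {x : X}
    (hx : x ∈ C + Metric.ball (0 : X) 1) :
    x ∈ convexHull ℝ ((C + Metric.ball (0 : X) 1) \ Metric.ball x (ε / 2)) := by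
  obtain ⟨c, hc, b, hb, rfl⟩ := Set.mem_add.1 hx
  rw [mem_ball_zero_iff] at hb
  obtain ⟨c', hc', hd⟩ := Metric.mem_closure_iff.1 (hC c hc) (min (1 - ‖b‖) (ε / 2))
    (lt_min (by linarith) (half_pos hε))
  rw [dist_eq_norm] at hd
  have hd1 := hd.trans_le (min_le_left _ _)
  have hd2 := hd.trans_le (min_le_right _ _)
  have hmem : (b + (c - c')) + c' ∈ convexHull ℝ
      ((b + (c - c')) +ᵥ (C \ Metric.ball c ε)) := by
    rw [convexHull_vadd]
    exact Set.vadd_mem_vadd_set hc'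
  have e : (b + (c - c')) + c' = c + b := by abel
  rw [e] at hmem
  refine convexHull_mono ?_ hmem
  rintro _ ⟨s, ⟨hsC, hsb⟩, rfl⟩
  change b + (c - c') + s ∈ _
  refine ⟨?_, fun h => hsb ?_⟩
  · rw [add_comm _ s]
    refine Set.add_mem_add hsC (mem_ball_zero_iff.2 ?_)
    exact (norm_add_le _ _).trans_lt (by linarith)
  · rw [mem_ball_iff_norm] at h ⊢
    have e2 : s - c = (b + (c - c') + s - (c + b)) - (c - c') := by abel
    rw [e2]
    exact (norm_sub_le _ _).trans_lt (by linarith)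

/-- A point of a convex hull is the mean of a simple function on the unit interval with values in
the set. -/
theorem exists_simpleFunc_integral_eq [CompleteSpace X] {S : Set X} {x : X}
    (hx : x ∈ convexHull ℝ S) :
    ∃ φ : SimpleFunc unitInterval X, (∀ s, φ s ∈ S) ∧ ∫ s, φ s = x := by
  obtain ⟨ι, _, c, z, hc0, hc1, hz, rfl⟩ := mem_convexHull_iff_exists_fintype.1 hx
  let _ : MeasurableSpace ι := ⊤
  have : DiscreteMeasurableSpace ι := ⟨fun _ => trivial⟩
  let ρ : Measure ι := ∑ i, ENNReal.ofReal (c i) • Measure.dirac i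
  have hρ : IsProbabilityMeasure ρ := by
    refine ⟨?_⟩
    simp only [ρ, Measure.coe_finsetSum, Finset.sum_apply, Measure.smul_apply, measure_univ,
      smul_eq_mul, mul_one]
    rw [← ENNReal.ofReal_sum_of_nonneg fun i _ => hc0 i, hc1, ENNReal.ofReal_one]
  have : Nonempty ι := by
    by_contra hne
    rw [not_nonempty_iff] at hne
    simp at hc1
  obtain ⟨f, hf, hfρ⟩ := Measure.exists_measurable_map_eq ρ
  refine ⟨⟨z ∘ f, fun y => hf (Set.toFinite (z ⁻¹' {y})).measurableSet,
    (Set.finite_range z).subset (Set.range_comp_subset_range f z)⟩, fun s => hz _, ?_⟩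
  change ∫ s, z (f s) = _
  rw [← integral_map hf.aemeasurable (StronglyMeasurable.of_discrete (f := z)).aestronglyMeasurable,
    hfρ, integral_finsetSum_measure fun i _ => ?_]
  swap
  · have := Measure.smul_finite (Measure.dirac i) (ENNReal.ofReal_ne_top (r := c i))
    exact Integrable.of_finite
  refine Finset.sum_congr rfl fun i _ => ?_
  rw [integral_smul_measure, integral_dirac, ENNReal.toReal_ofReal (hc0 i)]

end Splitting

section Walk

variable {X : Type*}

/-- The random walk in `X` on the sequence space `ℕ → [0, 1]` which starts at `x₀` and moves from
`x` to the point `φ x s`, where `s` is the next coordinate. -/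
def walk (φ : X → unitInterval → X) (x₀ : X) : ℕ → (ℕ → unitInterval) → X
  | 0, t => φ x₀ (t 0)
  | n + 1, t => φ (walk φ x₀ n t) (t (n + 1))

/-- The filtration of the sequence space generated by the coordinates. -/
noncomputable def coordFiltration :
    Filtration ℕ (inferInstance : MeasurableSpace (ℕ → unitInterval)) :=
  Filtration.natural (fun n t => t n) fun n => (measurable_pi_apply n).stronglyMeasurable

theorem measurable_coord (n : ℕ) :
    Measurable[coordFiltration n] fun t : ℕ → unitInterval => t n := by
  refine (comap_measurable _).mono ?_ le_rfl
  exact le_iSup₂_of_le (f := fun j (_ : j ≤ n) =>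
    MeasurableSpace.comap (fun t : ℕ → unitInterval => t j) inferInstance) n le_rfl le_rfl

/-- The `n`-th position of the walk is a simple function of the first coordinates. -/
theorem exists_simpleFunc_eq_walk (φ : X → SimpleFunc unitInterval X) (x₀ : X) (n : ℕ) :
    ∃ S : @SimpleFunc (ℕ → unitInterval) (coordFiltration n) X,
      ∀ t, S t = walk (fun x => φ x) x₀ n t := by
  induction n with
  | zero =>
    exact ⟨@SimpleFunc.comp _ _ _ (coordFiltration 0) _ (φ x₀) _ (measurable_coord 0),
      fun t => rfl⟩
  | succ n ih =>
    obtain ⟨S, hS⟩ := ih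
    let S' : @SimpleFunc (ℕ → unitInterval) (coordFiltration (n + 1)) X :=
      @SimpleFunc.mk _ (coordFiltration (n + 1)) _ S
        (fun x => coordFiltration.mono n.le_succ _
          (@SimpleFunc.measurableSet_fiber _ _ (coordFiltration n) S x))
        (@SimpleFunc.finite_range _ _ (coordFiltration n) S)
    refine ⟨@SimpleFunc.bind _ _ _ (coordFiltration (n + 1)) S' fun x =>
      @SimpleFunc.comp _ _ _ (coordFiltration (n + 1)) _ (φ x) _ (measurable_coord (n + 1)),
      fun t => ?_⟩
    change φ (S t) (t (n + 1)) = _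
    rw [hS]
    rfl

theorem walk_mem {φ : X → unitInterval → X} {x₀ : X} {D : Set X} (hx₀ : x₀ ∈ D)
    (hφ : ∀ x ∈ D, ∀ s, φ x s ∈ D) (n : ℕ) (t : ℕ → unitInterval) : walk φ x₀ n t ∈ D := by
  induction n with
  | zero => exact hφ _ hx₀ _
  | succ n ih => exact hφ _ ih _

variable [NormedAddCommGroup X] [NormedSpace ℝ X] [CompleteSpace X]

/-- The product of the Lebesgue measures on the sequence space `ℕ → [0, 1]`. -/
noncomputable abbrev coordMeasure : Measure (ℕ → unitInterval) :=
  Measure.infinitePi fun _ => volume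

/-- If `φ x` has mean `x` for all `x` in a set `D`, the walk in `D` is a martingale. -/
theorem martingale_walk {φ : X → SimpleFunc unitInterval X} {x₀ : X} {D : Set X} (hx₀ : x₀ ∈ D)
    (hφ : ∀ x ∈ D, ∀ s, φ x s ∈ D) (hmean : ∀ x ∈ D, ∫ s, φ x s = x) :
    Martingale (walk (fun x => φ x) x₀) coordFiltration coordMeasure := by
  classical
  choose S hS using exists_simpleFunc_eq_walk φ x₀
  have hS' : ∀ n, ⇑(S n) = walk (fun x => φ x) x₀ n := fun n => funext (hS n)
  have hadapt : StronglyAdapted coordFiltration (walk (fun x => φ x) x₀) := fun n => by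
    rw [← hS' n]
    exact @SimpleFunc.stronglyMeasurable _ _ (coordFiltration n) _ (S n)
  have hint : ∀ n, Integrable (walk (fun x => φ x) x₀ n) coordMeasure := by
    intro n
    obtain ⟨R, hR⟩ :=
      (@SimpleFunc.finite_range _ _ (coordFiltration n) (S n)).isBounded.exists_norm_le
    refine Integrable.of_bound
      ((hadapt n).mono (coordFiltration.le n)).aestronglyMeasurable R ?_
    refine Eventually.of_forall fun t => ?_
    rw [← hS n t]
    exact hR _ (Set.mem_range_self t)
  refine martingale_nat hadapt hint fun n => ?_
  have hindep : ProbabilityTheory.Indep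
      (MeasurableSpace.comap (fun t : ℕ → unitInterval => t (n + 1)) inferInstance)
      (coordFiltration n) coordMeasure := by
    have hi : ProbabilityTheory.iIndepFun (fun i (t : ℕ → unitInterval) => t i) coordMeasure :=
      ProbabilityTheory.iIndepFun_infinitePi (X := fun _ s => s) fun _ => measurable_id
    have := ProbabilityTheory.indep_iSup_of_disjoint
      (fun k => (measurable_pi_apply (X := fun _ : ℕ => unitInterval) k).comap_le) hi
      (S := {n + 1}) (T := {k | k ≤ n}) (by simp)
    rwa [iSup_singleton] at this
  -- Given the past, the next step from `x` has mean `x`, being independent of the past.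
  have hstep : ∀ x ∈ D, coordMeasure[fun t => φ x (t (n + 1)) | coordFiltration n]
      =ᵐ[coordMeasure] fun _ => x := by
    intro x hx
    have h1 := condExp_indep_eq
      (measurable_pi_apply (X := fun _ : ℕ => unitInterval) (n + 1)).comap_le
      (coordFiltration.le n)
      ((φ x).stronglyMeasurable.comp_measurable
        (comap_measurable fun t : ℕ → unitInterval => t (n + 1))) hindep
    have h2 : ∫ t, φ x (t (n + 1)) ∂coordMeasure = x := by
      refine Eq.trans ?_ (hmean x hx)
      rw [← Measure.infinitePi_map_eval (fun _ : ℕ => (volume : Measure unitInterval)) (n + 1)]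
      exact (integral_map
        (measurable_pi_apply (X := fun _ : ℕ => unitInterval) (n + 1)).aemeasurable
        (φ x).stronglyMeasurable.aestronglyMeasurable).symm
    refine h1.trans (Eventually.of_forall fun t => ?_)
    exact h2
  have hstepint : ∀ x, Integrable (fun t : ℕ → unitInterval => φ x (t (n + 1))) coordMeasure := by
    intro x
    obtain ⟨R, hR⟩ := (φ x).finite_range.isBounded.exists_norm_le
    exact Integrable.of_bound ((φ x).stronglyMeasurable.comp_measurable
      (measurable_pi_apply (n + 1))).aestronglyMeasurable R
      (Eventually.of_forall fun t => hR _ (Set.mem_range_self _))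
  let K : Finset X := (@SimpleFunc.finite_range _ _ (coordFiltration n) (S n)).toFinset
  have hK : ∀ x ∈ K, x ∈ D := by
    intro x hx
    obtain ⟨t, rfl⟩ := (Set.Finite.mem_toFinset _).1 hx
    rw [hS]
    exact walk_mem hx₀ hφ n t
  have hSK : ∀ t, S n t ∈ K := fun t => (Set.Finite.mem_toFinset _).2 (Set.mem_range_self t)
  have hfib : ∀ x, MeasurableSet[coordFiltration n] (S n ⁻¹' {x}) := fun x =>
    @SimpleFunc.measurableSet_fiber _ _ (coordFiltration n) (S n) x
  have hdecomp : ∀ F : X → (ℕ → unitInterval) → X,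
      (fun t => F (S n t) t) = ∑ x ∈ K, (S n ⁻¹' {x}).indicator (F x) := by
    intro F
    ext t
    rw [Finset.sum_apply, Finset.sum_eq_single (S n t)]
    · exact (Set.indicator_of_mem (s := S n ⁻¹' {S n t}) rfl _).symm
    · intro x _ hx
      exact Set.indicator_of_notMem (fun h => hx h.symm) _
    · exact fun h => (h (hSK t)).elim
  have e1 : walk (fun x => φ x) x₀ (n + 1)
      = ∑ x ∈ K, (S n ⁻¹' {x}).indicator fun t => φ x (t (n + 1)) := by
    rw [← hdecomp fun x t => φ x (t (n + 1))]
    ext t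
    rw [hS]
    rfl
  have e2 : walk (fun x => φ x) x₀ n = ∑ x ∈ K, (S n ⁻¹' {x}).indicator fun _ => x := by
    rw [← hdecomp fun x _ => x, ← hS']
  rw [e1, e2]
  refine EventuallyEq.symm ((condExp_finsetSum (fun x _ => (hstepint x).indicator
    (coordFiltration.le n _ (hfib x))) _).trans ?_)
  refine eventuallyEq_sum fun x hx => ?_
  refine (condExp_indicator (hstepint x) (hfib x)).trans ?_
  filter_upwards [hstep x (hK x hx)] with t ht
  by_cases h : t ∈ S n ⁻¹' {x}
  · rw [Set.indicator_of_mem h, Set.indicator_of_mem h, ht]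
  · rw [Set.indicator_of_notMem h, Set.indicator_of_notMem h]

end Walk

/-! ### The equivariant coordinate of a fundamental domain -/

/-- A continuous image, in a metric space, of a space in which disjoint families of nonempty open
sets are countable is separable: separated subsets of the image are countable. -/
theorem isSeparable_range_of_countable_disjoint_open {G Y : Type*} [TopologicalSpace G]
    [PseudoEMetricSpace Y] {p : G → Y} (hp : Continuous p)
    (hG : ∀ 𝒱 : Set (Set G), (∀ V ∈ 𝒱, IsOpen V ∧ V.Nonempty) → 𝒱.PairwiseDisjoint id →
      𝒱.Countable) :
    TopologicalSpace.IsSeparable (Set.range p) := by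
  suffices h : ∀ ε > 0, ∃ t : Set Y, t.Countable ∧
      Set.range p ⊆ ⋃ x ∈ t, Metric.closedEBall x ε by
    obtain ⟨t, -, ht, hcl⟩ := EMetric.subset_countable_closure_of_almost_dense_set _ h
    exact ⟨t, ht, hcl⟩
  intro ε hε
  obtain ⟨δ, hδ0, hδε⟩ := ENNReal.lt_iff_exists_nnreal_btwn.1 hε
  have hmax : ∃ N, Maximal (fun N => N ⊆ Set.range p ∧ Metric.IsSeparated δ N) N := by
    refine zorn_subset {N | N ⊆ Set.range p ∧ Metric.IsSeparated δ N} fun c hc hchain => ?_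
    refine ⟨⋃₀ c, ⟨Set.sUnion_subset fun N hN => (hc hN).1, ?_⟩, fun N hN =>
      Set.subset_sUnion_of_mem hN⟩
    exact (Set.pairwise_sUnion hchain.directedOn).2 fun N hN => (hc hN).2
  obtain ⟨N, hN⟩ := hmax
  refine ⟨N, ?_, ?_⟩
  · -- the balls of radius `δ / 2` around the points of `N` pull back to disjoint open sets
    have hdisj : ∀ y ∈ N, ∀ y' ∈ N, y ≠ y' →
        Disjoint (p ⁻¹' Metric.eball y (δ / 2)) (p ⁻¹' Metric.eball y' (δ / 2)) := by
      intro y hy y' hy' hne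
      refine (Metric.eball_disjoint ?_).preimage p
      rw [ENNReal.add_halves]
      exact (hN.prop.2 hy hy' hne).le
    have hne : ∀ y ∈ N, (p ⁻¹' Metric.eball y (δ / 2)).Nonempty := by
      intro y hy
      obtain ⟨g, rfl⟩ := hN.prop.1 hy
      exact ⟨g, Metric.mem_eball_self (ENNReal.half_pos hδ0.ne')⟩
    have hinj : Set.InjOn (fun y => p ⁻¹' Metric.eball y (δ / 2)) N := by
      intro y hy y' hy' he
      by_contra hyy
      have := hdisj y hy y' hy' hyy
      rw [show p ⁻¹' Metric.eball y (δ / 2) = p ⁻¹' Metric.eball y' (δ / 2) from he,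
        disjoint_self] at this
      exact (hne y' hy').ne_empty this
    refine Set.countable_of_injective_of_countable_image hinj (hG _ ?_ ?_)
    · rintro _ ⟨y, hy, rfl⟩
      exact ⟨Metric.isOpen_eball.preimage hp, hne y hy⟩
    · rintro _ ⟨y, hy, rfl⟩ _ ⟨y', hy', rfl⟩ hyy
      exact hdisj y hy y' hy' fun h => hyy (by rw [h])
  · refine (Metric.isCover_iff_subset_iUnion_closedEBall.1
      (Metric.IsCover.of_maximal_isSeparated hN)).trans ?_
    exact Set.iUnion₂_mono fun y _ => Metric.closedEBall_subset_closedEBall hδε.le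

section FundamentalDomain

variable {G : Type*} [Group G] [TopologicalSpace G] {Ω : Type*} [MeasurableSpace Ω]
  [MulAction G Ω] {μ : Measure Ω} [IsFiniteMeasure μ] {F : Set Ω}

/-- Translates of a fundamental domain turn disjoint open subsets of the group into disjoint sets
of positive measure. -/
theorem countable_of_pairwiseDisjoint_open
    (hdisj : ∀ g h : G, g ≠ h → Disjoint (g • F) (h • F))
    (hV : ∀ V : Set G, IsOpen V →
      NullMeasurableSet (⋃ g ∈ V, g • F) μ ∧ (V.Nonempty → 0 < μ (⋃ g ∈ V, g • F)))
    (𝒱 : Set (Set G)) (h𝒱 : ∀ V ∈ 𝒱, IsOpen V ∧ V.Nonempty) (hd : 𝒱.PairwiseDisjoint id) :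
    𝒱.Countable := by
  have h := Measure.countable_meas_pos_of_disjoint_iUnion₀ (μ := μ)
    (As := fun V : 𝒱 => ⋃ g ∈ (V : Set G), g • F) (fun V => (hV V (h𝒱 V V.2).1).1) ?_
  · have hu : {V : 𝒱 | 0 < μ (⋃ g ∈ (V : Set G), g • F)} = Set.univ :=
      Set.eq_univ_of_forall fun V => (hV V (h𝒱 V V.2).1).2 (h𝒱 V V.2).2
    rw [hu, Set.countable_univ_iff] at h
    exact Set.countable_coe_iff.1 h
  · intro V V' hne
    refine Disjoint.aedisjoint ?_
    simp only [Set.disjoint_iUnion_left, Set.disjoint_iUnion_right]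
    intro g hg g' hg'
    refine hdisj _ _ fun he => ?_
    have := hd V.2 V'.2 fun h => hne (Subtype.ext h)
    exact Set.disjoint_left.1 this hg' (he ▸ hg)

/-- A fundamental domain provides an equivariant map to the group whose orbit maps are
measurable. -/
theorem exists_equivariant_map_to_group
    (hcov : μ (⋃ g : G, g • F)ᶜ = 0)
    (hdisj : ∀ g h : G, g ≠ h → Disjoint (g • F) (h • F))
    (hV : ∀ V : Set G, IsOpen V →
      NullMeasurableSet (⋃ g ∈ V, g • F) μ ∧ (V.Nonempty → 0 < μ (⋃ g ∈ V, g • F))) :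
    ∃ γ : Ω → G, (∀ᵐ ω ∂μ, ∀ g : G, γ (g • ω) = g * γ ω) ∧
      ∀ {Y : Type v} [PseudoMetricSpace Y] (p : G → Y), Continuous p →
        AEStronglyMeasurable (fun ω => p (γ ω)) μ := by
  classical
  let γ : Ω → G := fun ω => if h : ∃ g : G, ω ∈ g • F then h.choose else 1
  have hγ : ∀ (g : G) (ω : Ω), ω ∈ g • F → γ ω = g := by
    intro g ω hω
    have h : ∃ g : G, ω ∈ g • F := ⟨g, hω⟩
    simp only [γ, dif_pos h]
    by_contra hne
    exact Set.disjoint_left.1 (hdisj _ _ hne) h.choose_spec hω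
  have hae : ∀ᵐ ω ∂μ, ∃ g : G, ω ∈ g • F := by
    filter_upwards [measure_eq_zero_iff_ae_notMem.1 hcov] with ω hω
    rw [Set.mem_compl_iff, not_not] at hω
    exact Set.mem_iUnion.1 hω
  refine ⟨γ, ?_, ?_⟩
  · filter_upwards [hae] with ω hω g
    obtain ⟨k, hk⟩ := hω
    rw [hγ k ω hk]
    refine hγ _ _ ?_
    rw [mul_smul]
    exact Set.smul_mem_smul_set hk
  · intro Y _ p hp
    borelize Y
    have hnull : NullMeasurable (fun ω => p (γ ω)) μ := by
      refine measurable_of_isOpen fun U hU => ?_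
      have hpU := (hV _ (hU.preimage hp)).1
      refine hpU.congr ?_
      filter_upwards [hae] with ω hω
      obtain ⟨k, hk⟩ := hω
      apply propext
      change ω ∈ (⋃ g ∈ p ⁻¹' U, g • F) ↔ p (γ ω) ∈ U
      rw [hγ k ω hk]
      simp only [Set.mem_iUnion, Set.mem_preimage, exists_prop]
      refine ⟨fun ⟨g, hg, hωg⟩ => ?_, fun h => ⟨k, h, hk⟩⟩
      rwa [← hγ k ω hk, hγ g ω hωg]
    have hsep : TopologicalSpace.IsSeparable (Set.range p) :=
      isSeparable_range_of_countable_disjoint_open hp fun 𝒱 =>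
        countable_of_pairwiseDisjoint_open hdisj hV 𝒱
    have hmem : ∀ᵐ ω ∂μ, p (γ ω) ∈ Set.range p := Eventually.of_forall fun ω => ⟨_, rfl⟩
    have := hsep.separableSpace
    have : SecondCountableTopology (Set.range p) :=
      UniformSpace.secondCountable_of_separable _
    exact aestronglyMeasurable_iff_aemeasurable_separable.2
      ⟨hnull.aemeasurable_of_aerange hmem, _, hsep, hmem⟩

end FundamentalDomain

/-! ### Convergence of bounded martingales implies dentability -/

section Skew

variable {Ω : Type*} [mΩ : MeasurableSpace Ω] {μ : Measure Ω} [IsFiniteMeasure μ]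
  {T : Type*} [mT : MeasurableSpace T] {ν : Measure T} [IsProbabilityMeasure ν]

/-- The filtration on `Ω × T` whose `n`-th σ-algebra consists of all of `Ω` and of the `n`-th
σ-algebra of a filtration on `T`. -/
def prodFiltration (Ω : Type*) [mΩ : MeasurableSpace Ω] {T : Type*} [mT : MeasurableSpace T]
    (ℱ : Filtration ℕ mT) : Filtration ℕ (mΩ.prod mT) where
  seq n := mΩ.prod (ℱ n)
  mono' _ _ h := sup_le_sup le_rfl (MeasurableSpace.comap_mono (ℱ.mono h))
  le' n := sup_le_sup le_rfl (MeasurableSpace.comap_mono (ℱ.le n))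

variable {X : Type*} [NormedAddCommGroup X] [NormedSpace ℝ X] [CompleteSpace X]

/-- A martingale on `T` with finitely many values at each time is moved to `Ω × T` by a family of
linear isometries depending on a point of `Ω`. The family `L` is given up to null sets by
measurable versions `a x` of its orbit maps, so that the new process is exactly adapted. -/
theorem martingale_skew {ℱ : Filtration ℕ mT} {N : ℕ → T → X}
    (hN : ∀ n, ∃ S : @SimpleFunc T (ℱ n) X, ∀ t, S t = N n t) (hmart : Martingale N ℱ ν)
    (L : Ω → X →L[ℝ] X) (hL : ∀ ω x, ‖L ω x‖ = ‖x‖) {R : ℝ} (hR : ∀ n t, ‖N n t‖ ≤ R)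
    (a : X → Ω → X) (ha : ∀ x, StronglyMeasurable (a x)) (haL : ∀ x, ∀ᵐ ω ∂μ, a x ω = L ω x) :
    (∀ᵐ ω ∂μ, ∀ n t, a (N n t) ω = L ω (N n t)) ∧
      Martingale (fun n (p : Ω × T) => a (N n p.2) p.1) (prodFiltration Ω ℱ) (μ.prod ν) := by
  classical
  choose S hS using hN
  have hS' : ∀ n, ⇑(S n) = N n := fun n => funext (hS n)
  have hfin : ∀ n, (Set.range (N n)).Finite := fun n => by
    rw [← hS' n]
    exact @SimpleFunc.finite_range _ _ (ℱ n) (S n)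
  have hae : ∀ᵐ ω ∂μ, ∀ n t, a (N n t) ω = L ω (N n t) := by
    refine ae_all_iff.2 fun n => ?_
    filter_upwards [(ae_ball_iff (hfin n).countable).2 fun x _ => haL x] with ω hω t
    exact hω _ ⟨t, rfl⟩
  refine ⟨hae, ?_⟩
  have hadapt : StronglyAdapted (prodFiltration Ω ℱ) fun n (p : Ω × T) => a (N n p.2) p.1 := by
    intro n
    have e : (fun p : Ω × T => a (N n p.2) p.1)
        = ∑ x ∈ (hfin n).toFinset, (Prod.snd ⁻¹' (N n ⁻¹' {x})).indicator fun p => a x p.1 := by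
      ext p
      rw [Finset.sum_apply, Finset.sum_eq_single (N n p.2)]
      · have hp : p ∈ (Prod.snd ⁻¹' (N n ⁻¹' {N n p.2}) : Set (Ω × T)) := rfl
        rw [Set.indicator_of_mem hp]
      · intro x _ hx
        refine Set.indicator_of_notMem ?_ _
        exact fun h => hx (Eq.symm h)
      · exact fun h => (h ((hfin n).mem_toFinset.2 ⟨_, rfl⟩)).elim
    change StronglyMeasurable[prodFiltration Ω ℱ n] fun p : Ω × T => a (N n p.2) p.1
    rw [e]
    refine Finset.stronglyMeasurable_sum _ fun x _ => ?_
    have hfib : MeasurableSet[ℱ n] (N n ⁻¹' {x}) := by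
      rw [← hS' n]
      exact @SimpleFunc.measurableSet_fiber _ _ (ℱ n) (S n) x
    refine StronglyMeasurable.indicator ?_ ?_
    · exact (ha x).comp_measurable (@measurable_fst Ω T mΩ (ℱ n))
    · exact (@measurable_snd Ω T mΩ (ℱ n)) hfib
  have haeprod : ∀ᵐ p ∂(μ.prod ν), ∀ n, a (N n p.2) p.1 = L p.1 (N n p.2) := by
    filter_upwards [Measure.quasiMeasurePreserving_fst.ae hae] with p hp n using hp n p.2
  have hint : ∀ n, Integrable (fun p : Ω × T => a (N n p.2) p.1) (μ.prod ν) := by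
    intro n
    refine Integrable.of_bound
      ((hadapt n).mono ((prodFiltration Ω ℱ).le n)).aestronglyMeasurable R ?_
    filter_upwards [haeprod] with p hp
    rw [hp n, hL]
    exact hR n p.2
  have hNint : ∀ n, Integrable (N n) ν := hmart.integrable
  refine martingale_nat hadapt hint fun n => ?_
  refine ae_eq_condExp_of_forall_setIntegral_eq ((prodFiltration Ω ℱ).le n) (hint (n + 1))
    (fun A _ _ => (hint n).integrableOn) (fun A hA _ => ?_) (hadapt n).aestronglyMeasurable
  have hA' : MeasurableSet A := (prodFiltration Ω ℱ).le n A hA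
  -- By Fubini both integrals are computed on the sections of `A`, which belong to `ℱ n`.
  have hsec : ∀ ω, MeasurableSet[ℱ n] (Prod.mk ω ⁻¹' A) := fun ω =>
    (@measurable_prodMk_left Ω T mΩ (ℱ n) ω) hA
  have hfub : ∀ k, ∫ p in A, a (N k p.2) p.1 ∂(μ.prod ν)
      = ∫ ω, L ω (∫ t in Prod.mk ω ⁻¹' A, N k t ∂ν) ∂μ := by
    intro k
    rw [← integral_indicator hA', integral_prod _ ((hint k).indicator hA')]
    refine integral_congr_ae ?_
    filter_upwards [hae] with ω hω
    rw [← (L ω).integral_comp_comm (hNint k).integrableOn,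
      ← integral_indicator (ℱ.le n _ (hsec ω))]
    refine integral_congr_ae (Eventually.of_forall fun t => ?_)
    by_cases ht : (ω, t) ∈ A
    · have ht' : t ∈ Prod.mk ω ⁻¹' A := ht
      simp only [Set.indicator_of_mem ht, Set.indicator_of_mem ht', hω]
    · have ht' : t ∉ Prod.mk ω ⁻¹' A := ht
      simp only [Set.indicator_of_notMem ht, Set.indicator_of_notMem ht']
  rw [hfub, hfub]
  refine integral_congr_ae (Eventually.of_forall fun ω => ?_)
  exact congrArg (L ω) (hmart.setIntegral_eq n.le_succ (hsec ω))

end Skew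

/-- A random walk in a set without denting points, transported to `Ω` by the equivariant map to
`G` of a fundamental domain, is a divergent equivariant martingale. -/
theorem MartingalesConverge.isWeaklyGDentable (G : Type u) [Group G] [TopologicalSpace G]
    (X : Type v) [NormedAddCommGroup X] [NormedSpace ℝ X] [CompleteSpace X]
    [DistribMulAction G X] [SMulCommClass G ℝ X] [IsIsometricSMul G X] [ContinuousSMul G X]
    (hF : PropertyF.{u, w} G) (hconv : MartingalesConverge.{u, v, w} G X) :
    IsWeaklyGDentable G X := by
  intro C hCne hCb _
  by_contra hnd
  simp only [IsDentable, not_forall, not_exists, not_and, not_not] at hnd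
  obtain ⟨ε, hε, hC⟩ := hnd
  obtain ⟨Ω, _, _, μ, _, h, hcont, -, F, -, hcov, hdisj, hV⟩ := hF
  obtain ⟨γ, hγ, hγm⟩ := exists_equivariant_map_to_group hcov hdisj hV
  -- a martingale in `D`, with increments of norm at least `ε / 2`
  let D : Set X := C + Metric.ball (0 : X) 1
  have hsplit : ∀ x : X, ∃ φ : SimpleFunc unitInterval X, x ∈ D →
      (∀ s, φ s ∈ D \ Metric.ball x (ε / 2)) ∧ ∫ s, φ s = x := by
    intro x
    by_cases hx : x ∈ D
    · obtain ⟨φ, hφ⟩ := exists_simpleFunc_integral_eq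
        (mem_convexHull_diff_ball_of_add_ball hε hC hx)
      exact ⟨φ, fun _ => hφ⟩
    · exact ⟨0, fun h => (hx h).elim⟩
  choose φ hφ using hsplit
  obtain ⟨c, hc⟩ := hCne
  have hx₀ : c + 0 ∈ D := Set.add_mem_add hc (Metric.mem_ball_self one_pos)
  set N := walk (fun x => φ x) (c + 0)
  have hφD : ∀ x ∈ D, ∀ s, φ x s ∈ D := fun x hx s => ((hφ x hx).1 s).1
  have hND : ∀ n t, N n t ∈ D := walk_mem hx₀ hφD
  have hmart := martingale_walk hx₀ hφD fun x hx => (hφ x hx).2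
  obtain ⟨R, hR⟩ := isBounded_iff_forall_norm_le.1 (hCb.add Metric.isBounded_ball)
  have hNR : ∀ n t, ‖N n t‖ ≤ R := fun n t => hR _ (hND n t)
  have hstep : ∀ n t, ε / 2 ≤ ‖N (n + 1) t - N n t‖ := by
    intro n t
    have := ((hφ _ (hND n t)).1 (t (n + 1))).2
    rw [mem_ball_iff_norm, not_lt] at this
    exact this
  -- its transport to `Ω × (ℕ → [0, 1])` by the coordinate `γ`
  let L : Ω → X →L[ℝ] X := fun ω =>
    { toFun := fun x => γ ω • x
      map_add' := smul_add (γ ω)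
      map_smul' := fun r x => smul_comm (γ ω) r x
      cont := (isometry_smul X (γ ω)).continuous }
  have hLm : ∀ x, AEStronglyMeasurable (fun ω => L ω x) μ := fun x =>
    hγm (fun g : G => g • x) (continuous_id.smul continuous_const)
  let a : X → Ω → X := fun x => (hLm x).mk _
  obtain ⟨hae, hM⟩ := martingale_skew (μ := μ) (fun n => exists_simpleFunc_eq_walk φ (c + 0) n)
    hmart L (fun ω x => norm_group_smul (γ ω) x) hNR a (fun x => (hLm x).stronglyMeasurable_mk)
    fun x => (hLm x).ae_eq_mk.symm
  set M : ℕ → Ω × (ℕ → unitInterval) → X := fun n p => a (N n p.2) p.1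
  let _ : MulAction G (ℕ → unitInterval) :=
    { smul := fun _ t => t
      one_smul := fun _ => rfl
      mul_smul := fun _ _ _ => rfl }
  have htriv : ∀ (g : G) (t : ℕ → unitInterval), g • t = t := fun _ _ => rfl
  have h' : IsPointAction G (μ.prod coordMeasure) := h.prod_of_trivial htriv
  have hcont' := h.isContinuous_prod_of_trivial htriv h' hcont
  have haeM : ∀ᵐ p ∂(μ.prod coordMeasure), ∀ n, M n p = γ p.1 • N n p.2 := by
    filter_upwards [Measure.quasiMeasurePreserving_fst.ae hae] with p hp n using hp n p.2
  have hMm : ∀ n, AEStronglyMeasurable (M n) (μ.prod coordMeasure) := fun n =>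
    ((hM.1 n).mono ((prodFiltration Ω coordFiltration).le n)).aestronglyMeasurable
  have hMR : ∀ n, ∀ᵐ p ∂(μ.prod coordMeasure), ‖M n p‖ ≤ R := by
    intro n
    filter_upwards [haeM] with p hp
    rw [hp n, norm_group_smul]
    exact hNR n p.2
  have hMeq : IsEquivariantMartingale h'.setAction M := by
    refine ⟨fun n => h'.isEquivariantOnSets (hMm n) (hMR n) fun g => ?_,
      prodFiltration Ω coordFiltration, fun n g A hA => ⟨g • A, ?_, EventuallyEq.rfl⟩, hM⟩
    · have hq : Measure.QuasiMeasurePreserving (fun p : Ω × (ℕ → unitInterval) => g • p)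
          (μ.prod coordMeasure) (μ.prod coordMeasure) :=
        ⟨h'.measurable_smul g, h'.map_absolutelyContinuous g⟩
      filter_upwards [haeM, hq.ae haeM, Measure.quasiMeasurePreserving_fst.ae hγ] with p h1 h2 h3
      rw [h1 n, h2 n]
      change γ (g • p.1) • N n p.2 = _
      rw [h3 g, mul_smul]
    · rw [← Set.preimage_smul_inv]
      have : @Measurable _ _ ((inferInstance : MeasurableSpace Ω).prod (coordFiltration n))
          ((inferInstance : MeasurableSpace Ω).prod (coordFiltration n))
          fun p : Ω × (ℕ → unitInterval) => (g⁻¹ • p.1, p.2) :=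
        @Measurable.prodMk _ ((inferInstance : MeasurableSpace Ω).prod (coordFiltration n)) _ _ _
          (coordFiltration n) _ _
          ((h.measurable_smul g⁻¹).comp (@measurable_fst _ _ _ (coordFiltration n)))
          (@measurable_snd _ _ _ (coordFiltration n))
      exact this hA
  obtain ⟨f, -, hlim, -⟩ := hconv _ (μ.prod coordMeasure) h'.setAction hcont' M hMeq ⟨R, hMR⟩
  have hμ : μ ≠ 0 := by
    intro h0
    have := (hV Set.univ isOpen_univ).2 ⟨1, trivial⟩
    rw [h0] at this
    simp at this
  have : NeZero (μ.prod (coordMeasure : Measure (ℕ → unitInterval))) := by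
    refine ⟨fun h0 => hμ ?_⟩
    have h1 : (μ.prod (coordMeasure : Measure (ℕ → unitInterval))) Set.univ = μ Set.univ := by
      rw [← Set.univ_prod_univ, Measure.prod_prod,
        measure_univ (μ := (coordMeasure : Measure (ℕ → unitInterval))), mul_one]
    rw [← Measure.measure_univ_eq_zero, ← h1, h0]
    rfl
  obtain ⟨p, hp, hpM⟩ := (hlim.and haeM).exists
  have h0 : Tendsto (fun n => ‖M (n + 1) p - M n p‖) atTop (𝓝 0) := by
    have := ((hp.comp (tendsto_add_atTop_nat 1)).sub hp).norm
    rwa [sub_self, norm_zero] at this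
  obtain ⟨n, hn⟩ := (h0.eventually (gt_mem_nhds (half_pos hε))).exists
  rw [hpM, hpM, ← smul_sub, norm_group_smul] at hn
  exact absurd (hstep n p.2) (not_le.2 hn)

end EquivRNP

theorem mainTheorem4 (G : Type u) [Group G] [TopologicalSpace G] [IsTopologicalGroup G]
    [T2Space G]
    (X : Type v) [NormedAddCommGroup X] [NormedSpace ℝ X] [CompleteSpace X]
    [DistribMulAction G X] [SMulCommClass G ℝ X] [IsIsometricSMul G X] [ContinuousSMul G X] :
    (EquivRNP.HasGRNP.{u, v, max u w} G X → EquivRNP.MartingalesConverge.{u, v, max u w} G X) ∧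
    (EquivRNP.PropertyF.{u, max u w} G → EquivRNP.MartingalesConverge.{u, v, max u w} G X →
      EquivRNP.IsWeaklyGDentable G X) ∧
    (TopologicalSpace.SeparableSpace G → EquivRNP.IsWeaklyGDentable G X →
      EquivRNP.HasGRNP.{u, v, max u w} G X) ∧
    (LocallyCompactSpace G → SigmaCompactSpace G → TopologicalSpace.SeparableSpace G →
      List.TFAE [EquivRNP.HasGRNP.{u, v, max u w} G X,
        EquivRNP.MartingalesConverge.{u, v, max u w} G X,
        EquivRNP.IsWeaklyGDentable G X]) := by
  refine ⟨EquivRNP.HasGRNP.martingalesConverge G X,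
    EquivRNP.MartingalesConverge.isWeaklyGDentable G X,
    fun _ => EquivRNP.IsWeaklyGDentable.hasGRNP G X, fun _ _ _ => ?_⟩
  tfae_have 1 → 2 := EquivRNP.HasGRNP.martingalesConverge G X
  tfae_have 2 → 3 := EquivRNP.MartingalesConverge.isWeaklyGDentable G X
    (EquivRNP.propertyF_of_locallyCompact.{u, w} G)
  tfae_have 3 → 1 := EquivRNP.IsWeaklyGDentable.hasGRNP G X
  tfae_finish
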